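/- Let $G$ be a connected, simply-connected, simple algebraic group over an algebraically closed field of characteristic zero, with a maximal torus and a Borel subgroup containing it, Weyl group $W$ (with its Bruhat order and length), and dominant weights $\Lambda^+$. For $\nu\in\Lambda^+$ let $W_\nu$ be its stabilizer in $W$; $W/W_\nu$ carries the Bruhat order. For $W_\nu\subseteq W_\mu$ we write $\pi$ for the projection $W/W_\nu\to W/W_\mu$. Fix $\underline\lambda=(\lambda_1,\dots,\lambda_m)$ in $\Lambda^+$ with sum $\lambda$, put $W_Q=W_\lambda$, and fix $\tau\in W/W_Q$. Fix a set $\mathcal I$ of non-empty subsets of $\{1,\dots,m\}$, ordered by inclusion, that is graded of length $m-1$ (all its maximal chains have $m$ elements) and satisfies $\underline J\subseteq I\Rightarrow J\subseteq I$ for all $I,J\in\mathcal I$; here $\underline J=J$ if $J$ is minimal in $\mathcal I$, and otherwise $\underline J$ is the union of all $J\setminus K$ with $K\in\mathcal I$ covered by $J$. For $I\in\mathcal I$ put $\lambda_I=\sum_{i\in\underline I}\lambda_i$ and $W_{P_I}=W_{\lambda_I}\supseteq W_Q$; each $\theta \in W/W_{P_I}$ has a unique minimal lift $\min_Q(\theta)$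 and a unique maximal lift $\max_Q(\theta)$ in $W/W_Q$. **Tableaux.** An LS-path of shape $\nu\in\Lambda^+$ is a tuple $(\sigma_p>\dots>\sigma_1;\,0,d_p,\dots,d_1=1)$, $p\ge 1$, consisting of a chain in $W/W_\nu$ and rationals $0<d_p<\dots<d_1=1$ such that for each $i=2,\dots,p$ there is a chain of covering relations $\sigma_i=\kappa_t>\dots>\kappa_0=\sigma_{i-1}$ in $W/W_\nu$ with $d_i\langle\kappa_j(\nu),\beta_j^\vee\rangle\in\mathbb Z$ for all $j=1,\dots,t$, where $\beta_j$ is the positive root for which $s_{\beta_j}$ maps the minimal representative of $\kappa_{j-1}$ in $W$ to that of $\kappa_j$. An LS-tableau of shape $(\mu_1,\dots,\mu_s)$ is a sequence $(\pi_1,\dots,\pi_s)$ of LS-paths $\pi_k$ of shape $\mu_k$; it is of type $(\underline\lambda,\mathcal I)$ if $\mu_k=\lambda_{I_k}$ for a (possibly empty) sequence $I_1\supseteq\dots\supseteq I_s$ in $\mathcal I$. Let $\mu=\mu_1+\dots+\mu_s$ and let $\sigma^{(k)}_{p_k}>\dots>\sigma^{(k)}_1$ be the cosets of $\pi_k$.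 For an element $\tau'\in W/W_\mu$ the tableau is $\tau'$-standard if there is a weakly decreasing sequence $$\tau'\ge\overline\sigma^{(1)}_{p_1}\ge\dots\ge\overline\sigma^{(1)}_1\ge\dots\ge\overline\sigma^{(s)}_{p_s}\ge\dots\ge\overline\sigma^{(s)}_1$$ in $W/W_\mu$ such that each $\overline\sigma^{(k)}_j$ projects to $\sigma^{(k)}_j\in W/W_{\mu_k}$. It is weakly $\tau'$-standard if each pair $(\pi_k,\pi_{k+1})$ of consecutive columns and each single column $(\pi_k)$ is standard with respect to the projection of $\tau'$. A tableau of type $(\underline\lambda,\mathcal I)$ is called (weakly) $\tau$-standard if it is (weakly) $\pi(\tau)$-standard, where $\pi(\tau)\in W/W_\mu$. **Posets.** Let $W(\underline\lambda,\tau)=\{\sigma\in W/W_Q\mid\sigma\le\tau\}\times\mathcal I$ with the product order, and let $\underline W(\underline\lambda,\tau)$ be the set of all pairs $(\theta,I)$ with $I\in\mathcal I$, $\theta\in W/W_{P_I}$, $\theta\le\pi(\tau)$, ordered by the transitive hull of the relation $$(\theta,I)\ge(\phi,J)\ :\Longleftrightarrow\ I\supseteq J\ \text{ and }\ \textstyle\max_Q(\theta)\ge\min_Q(\phi).\qquad(*)$$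 A chain $(\theta_\ell,I_\ell)>\dots>(\theta_0,I_0)$ in $\underline W(\underline\lambda,\tau)$ is $\tau$-standard if it has a defining chain, that is, a chain $(\overline\theta_\ell,I_\ell)>\dots>(\overline\theta_0,I_0)$ in $W(\underline\lambda,\tau)$ such that $\overline\theta_k$ projects to $\theta_k$ for all $k$. A $\tau$-standard chain is maximal if it is not properly contained in another $\tau$-standard chain; such a chain has a unique defining chain. The defining chain poset $D(\underline\lambda,\tau)$ is the set of all elements of $W(\underline\lambda,\tau)$ contained in the defining chain of some maximal $\tau$-standard chain, ordered by: $x\succeq y$ if and only if $x\ge y$ in $W(\underline\lambda,\tau)$ and both $x,y$ lie in the defining chain of one maximal $\tau$-standard chain. The poset $\mathcal I$ is called $\tau$-standard if $\rho:D(\underline\lambda,\tau)\to\underline W(\underline\lambda,\tau)$, $(\theta,I)\mapsto(\pi(\theta),I)$, is an isomorphism of posets. **Proposition.** The poset $\mathcal I$ is $\tau$-standard if and only if every weakly $\tau$-standard LS-tableau of type $(\underline\lambda,\mathcal I)$ is $\tau$-standard. In this case the relation $(*)$ on $\underline W(\underline\lambda,\tau)$ is transitive. -/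

import Mathlib

/-!
Root-theoretic setting.  A connected, simply-connected, simple algebraic group with maximal torus
and Borel subgroup is encoded by its irreducible reduced crystallographic root system `P` (over `ℚ`)
with a base `b`.  The weight lattice is the lattice of all vectors which pair integrally with the
coroots.  A parabolic subgroup containing the Borel subgroup enters only through its Weyl subgroup,
which is always given as the stabilizer of a dominant weight.
-/

noncomputable section

namespace LSTableaux

open RootPairing

variable {ι M N : Type*} [AddCommGroup M] [Module ℚ M] [AddCommGroup N] [Module ℚ N]
  {P : RootPairing ι ℚ M N}

/-! ### Weights, the Weyl group, its cosets and the Bruhat order -/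

/-- Dominant integral weights with respect to the base `b`. -/
def IsDominantWeight (b : P.Base) (ν : M) : Prop :=
  (∀ i : ι, ∃ z : ℤ, P.toLinearMap ν (P.coroot i) = z) ∧
    ∀ i ∈ b.support, 0 ≤ P.toLinearMap ν (P.coroot i)

/-- The stabilizer `W_ν` of `ν` in the Weyl group. -/
abbrev stab (P : RootPairing ι ℚ M N) (ν : M) : Subgroup P.weylGroup :=
  MulAction.stabilizer P.weylGroup ν

/-- The set of left cosets `W / W_ν`. -/
abbrev Cosets (P : RootPairing ι ℚ M N) (ν : M) : Type _ := P.weylGroup ⧸ stab P ν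

/-- Length of a Weyl group element: the smallest number of factors in a decomposition into simple
reflections. -/
def length (b : P.Base) (w : P.weylGroup) : ℕ :=
  sInf {n : ℕ | ∃ l : List ι, (∀ i ∈ l, i ∈ b.support) ∧ l.length = n ∧
    (l.map (weylGroup.ofIdx P)).prod = w}

/-- Bruhat order on the Weyl group: `u ≤ v` if `v` is obtained from `u` by successive left
multiplications with reflections, each of which increases the length. -/
def bruhatLE (b : P.Base) (u v : P.weylGroup) : Prop :=
  Relation.ReflTransGen
    (fun x y => (∃ i : ι, y = weylGroup.ofIdx P i * x) ∧ length b x < length b y) u v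

/-- Bruhat order on `W / W_ν`. -/
def cosetLE (b : P.Base) {ν : M} (θ φ : Cosets P ν) : Prop :=
  ∃ u v : P.weylGroup, (u : Cosets P ν) = θ ∧ (v : Cosets P ν) = φ ∧ bruhatLE b u v

def cosetLT (b : P.Base) {ν : M} (θ φ : Cosets P ν) : Prop :=
  cosetLE b θ φ ∧ θ ≠ φ

/-- `φ` covers `θ` in `W / W_ν`. -/
def cosetCovBy (b : P.Base) {ν : M} (θ φ : Cosets P ν) : Prop :=
  cosetLT b θ φ ∧ ∀ ψ : Cosets P ν, cosetLT b θ ψ → ¬ cosetLT b ψ φ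

/-- The projection `W / W_ν → W / W_μ`, `w W_ν ↦ w W_μ`.  It is only used for `W_ν ⊆ W_μ`, where it
does not depend on the representative (see `proj_mk`). -/
def proj {ν : M} (μ : M) (θ : Cosets P ν) : Cosets P μ :=
  ((Quotient.out θ : P.weylGroup) : Cosets P μ)

theorem proj_mk {ν μ : M} (h : stab P ν ≤ stab P μ) (w : P.weylGroup) :
    proj μ (w : Cosets P ν) = (w : Cosets P μ) := by
  have h1 : ((Quotient.out (w : Cosets P ν) : P.weylGroup) : Cosets P ν) = w :=
    QuotientGroup.out_eq' _
  exact QuotientGroup.eq.mpr (h (QuotientGroup.eq.mp h1))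

/-- `a` is the unique maximal lift `max(θ)` of `θ ∈ W / W_μ` to `W / W_ν`. -/
def IsMaxLift (b : P.Base) {ν μ : M} (a : Cosets P ν) (θ : Cosets P μ) : Prop :=
  proj μ a = θ ∧ ∀ a' : Cosets P ν, proj μ a' = θ → cosetLE b a' a

/-- `a` is the unique minimal lift `min(θ)` of `θ ∈ W / W_μ` to `W / W_ν`. -/
def IsMinLift (b : P.Base) {ν μ : M} (a : Cosets P ν) (θ : Cosets P μ) : Prop :=
  proj μ a = θ ∧ ∀ a' : Cosets P ν, proj μ a' = θ → cosetLE b a a'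

/-- `u ∈ W` is the smallest representative of the coset `κ`. -/
def IsMinRep (b : P.Base) {ν : M} (u : P.weylGroup) (κ : Cosets P ν) : Prop :=
  (u : Cosets P ν) = κ ∧ ∀ u' : P.weylGroup, (u' : Cosets P ν) = κ → bruhatLE b u u'

/-! ### LS-paths and LS-tableaux -/

/-- One step `κ > κ'` of an `(a, ν)`-chain: `κ` covers `κ'`, and `a ⟨κ(ν), β^∨⟩` is an integer, where
`β` is the positive root with `s_β min(κ') = min(κ)`. -/
def LSStep (b : P.Base) (ν : M) (a : ℚ) (κ κ' : Cosets P ν) : Prop :=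
  cosetCovBy b κ' κ ∧
    ∃ (i : ι) (u v : P.weylGroup), b.IsPos i ∧ IsMinRep b u κ' ∧ IsMinRep b v κ ∧
      weylGroup.ofIdx P i * u = v ∧ ∃ z : ℤ, a * P.toLinearMap (v • ν) (P.coroot i) = z

/-- There is an `(a, ν)`-chain from `σ` down to `σ'`. -/
def HasLSChain (b : P.Base) (ν : M) (a : ℚ) (σ σ' : Cosets P ν) : Prop :=
  Relation.ReflTransGen (LSStep b ν a) σ σ'

/-- LS-paths `(σ_p > ⋯ > σ_1; 0, d_p, …, d_1 = 1)` of shape `ν`, where `p = n + 1` and `σ_{k+1}`,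
`d_{k+1}` are the values of `σ`, `d` at `k`. -/
structure LSPath (b : P.Base) (ν : M) where
  n : ℕ
  σ : Fin (n + 1) → Cosets P ν
  d : Fin (n + 1) → ℚ
  σ_lt : ∀ k : Fin n, cosetLT b (σ k.castSucc) (σ k.succ)
  d_lt : ∀ k : Fin n, d k.succ < d k.castSucc
  d_one : d 0 = 1
  d_pos : 0 < d (Fin.last n)
  chain : ∀ k : Fin n, HasLSChain b ν (d k.succ) (σ k.succ) (σ k.castSucc)

/-- LS-tableaux: finite sequences of LS-paths (the columns) of arbitrary shapes. -/
abbrev LSTableau (b : P.Base) : Type _ := List (Σ ν : M, LSPath b ν)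

/-- The shape `(μ_1, …, μ_s)` of a tableau. -/
def shape {b : P.Base} (T : LSTableau b) : List M := T.map Sigma.fst

/-- The total weight `μ = μ_1 + ⋯ + μ_s`. -/
def weight {b : P.Base} (T : LSTableau b) : M := (shape T).sum

/-- The cosets of the columns in the order
`σ_{p_1}^{(1)}, …, σ_1^{(1)}, …, σ_{p_s}^{(s)}, …, σ_1^{(s)}`. -/
def entries {b : P.Base} (T : LSTableau b) : List (Σ ν : M, Cosets P ν) :=
  T.flatMap fun c => (List.ofFn fun k => (⟨c.1, c.2.σ k⟩ : Σ ν : M, Cosets P ν)).reverse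

/-- `T` is `τ`-standard for `τ ∈ W / W_μ`: there is a defining chain, i.e. a weakly decreasing
sequence in `W / W_μ`, bounded by `τ`, which lifts the cosets of the columns. -/
def IsStandard {b : P.Base} (T : LSTableau b) (τ : Cosets P (weight T)) : Prop :=
  ∃ c : List (Cosets P (weight T)),
    (τ :: c).IsChain (fun x y => cosetLE b y x) ∧
      List.Forall₂ (fun x e => proj e.1 x = e.2) c (entries T)

/-- `T` is weakly `τ`-standard for `τ ∈ W / W_μ`: each pair of consecutive columns is `τ`-standard,
as is each single column (the latter follows from the former unless there is only one column). -/
def IsWeaklyStandard {b : P.Base} (T : LSTableau b) (τ : Cosets P (weight T)) : Prop :=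
  (∀ p ∈ T, IsStandard [p] (proj (weight [p]) τ)) ∧
    ∀ p q, [p, q] <:+: T → IsStandard [p, q] (proj (weight [p, q]) τ)

/-! ### Index posets -/

section IndexPoset

variable {m : ℕ}

open Classical in
/-- The subset `underline J ⊆ J`: it is `J` itself if `J` is minimal, and otherwise the union of the
sets `J \ K` over all `K` covered by `J`. -/
def underline {𝓘 : Set (Finset (Fin m))} (J : 𝓘) : Finset (Fin m) :=
  J.1.filter fun i => IsMin J ∨ ∃ K : 𝓘, K ⋖ J ∧ i ∉ K.1

/-- `𝓘` is a subposet of the power set without the empty set; it is graded of length `m - 1`, i.e.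
all its maximal chains have `m` elements; and `underline J ⊆ I` implies `J ⊆ I`. -/
structure IsIndexPoset (𝓘 : Set (Finset (Fin m))) : Prop where
  empty_notMem : ∅ ∉ 𝓘
  graded : ∀ C : Set 𝓘, IsMaxChain (· ≤ ·) C → C.ncard = m
  underline_subset : ∀ J I : 𝓘, underline J ⊆ I.1 → J.1 ⊆ I.1

/-- The weight `λ_I`, the sum of all `λ_i` with `i ∈ underline I`. -/
def colWeight (lam : Fin m → M) {𝓘 : Set (Finset (Fin m))} (I : 𝓘) : M :=
  ∑ i ∈ underline I, lam i

/-- `T` is an LS-tableau of type `(λ, 𝓘)`. -/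
def IsOfType {b : P.Base} (lam : Fin m → M) (𝓘 : Set (Finset (Fin m))) (T : LSTableau b) : Prop :=
  ∃ Is : List 𝓘, Is.IsChain (fun I J => J ≤ I) ∧ shape T = Is.map (colWeight lam)

/-! ### The posets `W(λ, τ)`, `underline W(λ, τ)` and the defining chain poset

Here `W_Q` is the stabilizer of `λ = ∑ i, λ_i`, and `W_{P_I}` is the stabilizer of `λ_I`. -/

variable (b : P.Base) (lam : Fin m → M) (𝓘 : Set (Finset (Fin m))) (τ : Cosets P (∑ i, lam i))

/-- `W(λ, τ) = {σ ∈ W / W_Q | σ ≤ τ} × 𝓘`. -/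
def WUp : Type _ := {x : Cosets P (∑ i, lam i) × 𝓘 // cosetLE b x.1 τ}

/-- `underline W(λ, τ)`, the disjoint union of the sets `{θ ∈ W / W_{P_I} | θ ≤ π_{P_I}(τ)}`. -/
def WLow : Type _ :=
  {x : Σ I : 𝓘, Cosets P (colWeight lam I) // cosetLE b x.2 (proj (colWeight lam x.1) τ)}

variable {b lam 𝓘 τ}

/-- The order `x ≥ y` on `W(λ, τ)`. -/
def WUp.GE (x y : WUp b lam 𝓘 τ) : Prop :=
  y.1.2 ≤ x.1.2 ∧ cosetLE b y.1.1 x.1.1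

def WUp.GT (x y : WUp b lam 𝓘 τ) : Prop := x.GE y ∧ x ≠ y

/-- The map `(θ, I) ↦ (π_{P_I}(θ), I)`. -/
def WUp.down (x : WUp b lam 𝓘 τ) : Σ I : 𝓘, Cosets P (colWeight lam I) :=
  ⟨x.1.2, proj (colWeight lam x.1.2) x.1.1⟩

/-- The relation `I ⊇ J` and `max_Q(θ) ≥ min_Q(φ)` between `x = (θ, I)` and `y = (φ, J)`. -/
def WLow.Rel (x y : WLow b lam 𝓘 τ) : Prop :=
  y.1.1 ≤ x.1.1 ∧ ∃ a c : Cosets P (∑ i, lam i),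
    IsMaxLift b a x.1.2 ∧ IsMinLift b c y.1.2 ∧ cosetLE b c a

/-- The order `x ≥ y` on `underline W(λ, τ)`, the transitive hull of `WLow.Rel`. -/
def WLow.GE (x y : WLow b lam 𝓘 τ) : Prop := Relation.TransGen WLow.Rel x y

def WLow.GT (x y : WLow b lam 𝓘 τ) : Prop := x.GE y ∧ x ≠ y

/-- `d` is a defining chain of the chain `c` (both are listed decreasingly). -/
def IsDefiningChain (d : List (WUp b lam 𝓘 τ)) (c : List (WLow b lam 𝓘 τ)) : Prop :=
  d.IsChain WUp.GT ∧ List.Forall₂ (fun x y => x.down = y.1) d c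

/-- `c` is a `τ`-standard chain in `underline W(λ, τ)`. -/
def IsStandardChain (c : List (WLow b lam 𝓘 τ)) : Prop :=
  c.IsChain WLow.GT ∧ ∃ d, IsDefiningChain d c

/-- `c` is a maximal `τ`-standard chain: it is not properly contained in a `τ`-standard chain. -/
def IsMaxStandardChain (c : List (WLow b lam 𝓘 τ)) : Prop :=
  IsStandardChain c ∧ ∀ c', IsStandardChain c' → c.Sublist c' → c' = c

variable (b lam 𝓘 τ)

/-- The underlying set of the defining chain poset `D(λ, τ)`: all elements of `W(λ, τ)` which occur
in the (unique) defining chain of a maximal `τ`-standard chain. -/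
def DCP : Set (WUp b lam 𝓘 τ) :=
  {x | ∃ c d, IsMaxStandardChain c ∧ IsDefiningChain d c ∧ x ∈ d}

variable {b lam 𝓘 τ}

/-- The order `x ⪰ y` on `D(λ, τ)`. -/
def DCP.GE (x y : DCP b lam 𝓘 τ) : Prop :=
  WUp.GE x.1 y.1 ∧ ∃ c d, IsMaxStandardChain c ∧ IsDefiningChain d c ∧ x.1 ∈ d ∧ y.1 ∈ d

variable (b lam 𝓘 τ)

/-- The index poset `𝓘` is `τ`-standard: the map `ρ : D(λ, τ) → underline W(λ, τ)`,
`(θ, I) ↦ (π_{P_I}(θ), I)`, is an isomorphism of posets. -/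
def IsTauStandard : Prop :=
  ∃ ρ : (DCP.GE (b := b) (lam := lam) (𝓘 := 𝓘) (τ := τ)) ≃r
      (WLow.GE (b := b) (lam := lam) (𝓘 := 𝓘) (τ := τ)),
    ∀ x, (ρ x).1 = x.1.down

end IndexPoset

end LSTableaux

end

noncomputable section

namespace LSTableaux

open RootPairing

variable {ι M N : Type*} [AddCommGroup M] [Module ℚ M] [AddCommGroup N] [Module ℚ N]
  {P : RootPairing ι ℚ M N}

/-! ### Roots and reflections -/

/-! Both sides of the equivalence amount to `ChainsLift`: sequences in `WLow` that decrease for (*)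
lift to decreasing sequences in `WUp`.

If `ρ` is an isomorphism, its inverse is a monotone section of the projection from `WUp` to `WLow`.
Consecutive entries of a weakly standard tableau are comparable in `WLow`, so the section turns them
into a defining chain. The same section makes (*) transitive, because the order on `WUp` is
transitive and projects to (*).

Conversely, suppose that weakly standard tableaux are standard. A (*)-decreasing sequence is read as
a tableau of one-coset columns. Since (*) compares lifts that need not lie below τ, an element is
first inserted between neighbours (`exists_refinement`); then adjacent pairs have lifts below τ, the
tableau is weakly standard, and its defining chain is the required lift.

The core is that `ChainsLift` makes `ρ` an isomorphism, i.e. that an element of `WLow` has the same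
lift in all defining chains of maximal standard chains. Two facts carry this. First, a cover θ' ⋖ θ
comes with a reflection t such that w' ≤ w, with w' over θ' and w over θ, implies w' ≤ t w and t w'
≤ w (`exists_involution_of_covBy`). Second, every such defining chain ends in the trivial coset
(`IsMaxLiftChain.last_eq_one`): a minimality property is passed down the chain, so the last entry is
trivial in W/W_{P_K} for every level K of the chain, and these W_{P_K} intersect in W_Q. Together
they show that no entry can be enlarged, so the top coset is τ and each entry is the largest lift
below its predecessor and the smallest above its successor. Lifting the upper part of one maximal
chain glued to the lower part of another then compares their entries over a common element, in both
directions by symmetry. -/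

theorem weylGroup_ext {u v : P.weylGroup} (h : ∀ m : M, u • m = v • m) : u = v := by
  apply Subtype.ext
  apply Equiv.weightHom_injective P
  ext m
  exact h m

theorem root_smul (w : P.weylGroup) (i : ι) : P.root (w • i) = w • P.root i :=
  (P.weylGroup_apply_root w i).symm

theorem ofIdx_smul_index (i j : ι) : weylGroup.ofIdx P i • j = P.reflectionPerm i j := rfl

theorem ofIdx_smul_eq (i : ι) (m : M) :
    weylGroup.ofIdx P i • m = m - P.toLinearMap m (P.coroot i) • P.root i := by
  rw [weylGroup.ofIdx_smul, Equiv.reflection_smul, reflection_apply]; rfl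

@[simp] theorem ofIdx_mul_self (i : ι) : weylGroup.ofIdx P i * weylGroup.ofIdx P i = 1 := by
  apply weylGroup_ext
  intro m
  rw [mul_smul, one_smul]
  simp

@[simp] theorem ofIdx_inv (i : ι) : (weylGroup.ofIdx P i)⁻¹ = weylGroup.ofIdx P i :=
  inv_eq_of_mul_eq_one_left (ofIdx_mul_self i)

@[simp] theorem ofIdx_mul_cancel_left (i : ι) (w : P.weylGroup) :
    weylGroup.ofIdx P i * (weylGroup.ofIdx P i * w) = w := by
  rw [← mul_assoc, ofIdx_mul_self, one_mul]

@[simp] theorem mul_ofIdx_cancel_right (i : ι) (w : P.weylGroup) :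
    w * weylGroup.ofIdx P i * weylGroup.ofIdx P i = w := by
  rw [mul_assoc, ofIdx_mul_self, mul_one]

theorem toLinearMap_smul_coroot (w : P.weylGroup) (m : M) (i : ι) :
    P.toLinearMap (w • m) (P.coroot (w • i)) = P.toLinearMap m (P.coroot i) := by
  obtain ⟨w, hw⟩ := w
  induction hw using weylGroup.induction generalizing m i with
  | mem j =>
    change P.coroot' (P.reflectionPerm j i) (P.reflection j m) = _
    rw [coroot'_reflectionPerm]
    simp
  | one => rfl
  | mul x y hx hy h1 h2 =>
    have e : (⟨x * y, mul_mem hx hy⟩ : P.weylGroup) = ⟨x, hx⟩ * ⟨y, hy⟩ := rfl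
    rw [e, mul_smul, mul_smul, h1, h2]

theorem toLinearMap_smul_coroot' (w : P.weylGroup) (m : M) (i : ι) :
    P.toLinearMap (w • m) (P.coroot i) = P.toLinearMap m (P.coroot (w⁻¹ • i)) := by
  rw [← toLinearMap_smul_coroot w m (w⁻¹ • i), smul_inv_smul]

theorem smul_rat_smul (w : P.weylGroup) (q : ℚ) (m : M) : w • (q • m) = q • (w • m) :=
  smul_comm w.1 q m

theorem ofIdx_smul_conj (w : P.weylGroup) (i : ι) :
    weylGroup.ofIdx P (w • i) = w * weylGroup.ofIdx P i * w⁻¹ := by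
  apply weylGroup_ext
  intro m
  rw [mul_smul, mul_smul, ofIdx_smul_eq, ofIdx_smul_eq, smul_sub, smul_inv_smul, smul_rat_smul,
    root_smul, toLinearMap_smul_coroot' w⁻¹, inv_inv]

theorem mul_ofIdx_eq (w : P.weylGroup) (i : ι) :
    w * weylGroup.ofIdx P i = weylGroup.ofIdx P (w • i) * w := by
  rw [ofIdx_smul_conj, inv_mul_cancel_right]

theorem ofIdx_reflectionPerm_self (i : ι) :
    weylGroup.ofIdx P (P.reflectionPerm i i) = weylGroup.ofIdx P i := by
  rw [← ofIdx_smul_index, ofIdx_smul_conj]; simp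

theorem smul_reflectionPerm_self (w : P.weylGroup) (i : ι) :
    w • P.reflectionPerm i i = P.reflectionPerm (w • i) (w • i) := by
  rw [← ofIdx_smul_index, ← ofIdx_smul_index, ofIdx_smul_conj, mul_smul, mul_smul, inv_smul_smul]

/-! ### Positive roots, length and the exchange property -/

section Pos

variable [Finite ι] [P.IsCrystallographic] [P.IsReduced] (b : P.Base)

omit [Finite ι] [P.IsCrystallographic] [P.IsReduced] in
theorem isPos_reflectionPerm_self (i : ι) : b.IsPos (P.reflectionPerm i i) ↔ ¬ b.IsPos i :=
  Base.IsPos.neg_iff_not b i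

/-- Every root arises from a simple one by signs and simple reflections. A sign does not change the
reflection, and a simple reflection conjugates the word for it. -/
theorem exists_prod_ofIdx (w : P.weylGroup) :
    ∃ l : List ι, (∀ i ∈ l, i ∈ b.support) ∧ (l.map (weylGroup.ofIdx P)).prod = w := by
  obtain ⟨w, hw⟩ := w
  induction hw using weylGroup.induction with
  | mem j =>
    change ∃ l : List ι, (∀ i ∈ l, i ∈ b.support) ∧
      (l.map (weylGroup.ofIdx P)).prod = weylGroup.ofIdx P j
    induction j using b.induction_reflect with
    | h₀ i h => rwa [ofIdx_reflectionPerm_self]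
    | h₁ i h => exact ⟨[i], by simpa, by simp⟩
    | h₂ i j h hj =>
      obtain ⟨l, hl, e⟩ := h
      refine ⟨j :: (l ++ [j]), ?_, ?_⟩
      · intro k hk
        simp only [List.mem_cons, List.mem_append, List.not_mem_nil, or_false] at hk
        rcases hk with rfl | hk | rfl
        exacts [hj, hl _ hk, hj]
      · rw [← ofIdx_smul_index, ofIdx_smul_conj, ← e]
        simp [mul_assoc]
  | one => exact ⟨[], by simp, rfl⟩
  | mul x y hx hy h1 h2 =>
    obtain ⟨l, hl, e⟩ := h1
    obtain ⟨l', hl', e'⟩ := h2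
    refine ⟨l ++ l', ?_, ?_⟩
    · intro k hk
      rcases List.mem_append.mp hk with h | h
      exacts [hl _ h, hl' _ h]
    · rw [List.map_append, List.prod_append, e, e']; rfl

theorem exists_reduced (w : P.weylGroup) :
    ∃ l : List ι, (∀ i ∈ l, i ∈ b.support) ∧ l.length = length b w ∧
      (l.map (weylGroup.ofIdx P)).prod = w := by
  obtain ⟨l, hl, e⟩ := exists_prod_ofIdx b w
  exact Nat.sInf_mem (s := {n : ℕ | ∃ l : List ι, (∀ i ∈ l, i ∈ b.support) ∧ l.length = n ∧
    (l.map (weylGroup.ofIdx P)).prod = w}) ⟨_, l, hl, rfl, e⟩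

omit [Finite ι] [P.IsCrystallographic] [P.IsReduced] in
theorem length_prod_le {l : List ι} (hl : ∀ i ∈ l, i ∈ b.support) :
    length b (l.map (weylGroup.ofIdx P)).prod ≤ l.length :=
  Nat.sInf_le ⟨l, hl, rfl, rfl⟩

/-- A simple reflection makes no positive root negative except its own. Moved through the word from
the left, the root stays positive until it meets a letter equal to it; deleting that letter amounts
to multiplying by the reflection. -/
theorem strong_exchange {l : List ι} (hl : ∀ i ∈ l, i ∈ b.support) {i : ι} (hi : b.IsPos i)
    (h : ¬ b.IsPos ((l.map (weylGroup.ofIdx P)).prod⁻¹ • i)) :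
    ∃ l' : List ι, (∀ i ∈ l', i ∈ b.support) ∧ l'.length < l.length ∧
      (l'.map (weylGroup.ofIdx P)).prod =
        weylGroup.ofIdx P i * (l.map (weylGroup.ofIdx P)).prod := by
  induction l generalizing i with
  | nil => simp [hi] at h
  | cons j l ih =>
    by_cases hij : i = j
    · subst hij
      exact ⟨l, fun k hk => hl k (List.mem_cons_of_mem _ hk), by simp, by simp⟩
    have hj := hl j List.mem_cons_self
    have h' := hi.reflectionPerm hj hij
    simp only [List.map_cons, List.prod_cons, mul_inv_rev, ofIdx_inv, mul_smul,
      ofIdx_smul_index] at h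
    obtain ⟨l', h1, h2, h3⟩ := ih (fun k hk => hl k (List.mem_cons_of_mem _ hk)) h' h
    refine ⟨j :: l', ?_, by simpa, ?_⟩
    · intro k hk
      rcases List.mem_cons.mp hk with rfl | hk
      exacts [hj, h1 _ hk]
    · rw [← ofIdx_smul_index, ofIdx_smul_conj] at h3
      simp only [List.map_cons, List.prod_cons, h3, ofIdx_inv, mul_assoc, ofIdx_mul_cancel_left]

theorem length_ofIdx_mul_lt {i : ι} (hi : b.IsPos i) {u : P.weylGroup}
    (h : ¬ b.IsPos (u⁻¹ • i)) : length b (weylGroup.ofIdx P i * u) < length b u := by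
  obtain ⟨l, hl, hlen, rfl⟩ := exists_reduced b u
  obtain ⟨l', h1, h2, h3⟩ := strong_exchange b hl hi h
  rw [← h3, ← hlen]
  exact (length_prod_le b h1).trans_lt h2

theorem lt_length_ofIdx_mul {i : ι} (hi : b.IsPos i) {u : P.weylGroup}
    (h : b.IsPos (u⁻¹ • i)) : length b u < length b (weylGroup.ofIdx P i * u) := by
  have := length_ofIdx_mul_lt b hi (u := weylGroup.ofIdx P i * u) (by
    rw [mul_inv_rev, ofIdx_inv, mul_smul, ofIdx_smul_index, smul_reflectionPerm_self,
      isPos_reflectionPerm_self]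
    simpa)
  rwa [ofIdx_mul_cancel_left] at this

theorem length_lt_ofIdx_mul_iff {i : ι} (hi : b.IsPos i) (u : P.weylGroup) :
    length b u < length b (weylGroup.ofIdx P i * u) ↔ b.IsPos (u⁻¹ • i) := by
  refine ⟨fun h => ?_, lt_length_ofIdx_mul b hi⟩
  by_contra h'
  exact absurd (length_ofIdx_mul_lt b hi h') h.not_gt

theorem length_ofIdx_mul_lt_iff {i : ι} (hi : b.IsPos i) (u : P.weylGroup) :
    length b (weylGroup.ofIdx P i * u) < length b u ↔ ¬ b.IsPos (u⁻¹ • i) := by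
  refine ⟨fun h h' => ?_, length_ofIdx_mul_lt b hi⟩
  exact absurd (lt_length_ofIdx_mul b hi h') h.not_gt

omit [Finite ι] [P.IsCrystallographic] [P.IsReduced] in
/-- Every reflection is the reflection in a positive root. -/
theorem exists_isPos_ofIdx (i : ι) : ∃ j, b.IsPos j ∧ weylGroup.ofIdx P j = weylGroup.ofIdx P i := by
  by_cases h : b.IsPos i
  · exact ⟨i, h, rfl⟩
  · exact ⟨_, (isPos_reflectionPerm_self b i).mpr h, ofIdx_reflectionPerm_self i⟩

/-- Simple reflections permute the positive roots other than their own, and likewise the positive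
coroots, so the two notions agree by induction from the simple roots. Dominance is tested on
coroots, length on roots. -/
theorem isPos_iff_isPos_flip (i : ι) : b.IsPos i ↔ b.flip.IsPos i := by
  induction i using b.induction_reflect with
  | h₀ i h =>
    rw [isPos_reflectionPerm_self, h]
    exact (isPos_reflectionPerm_self b.flip i).symm
  | h₁ i h => exact iff_of_true (b.isPos_of_mem_support h) (b.flip.isPos_of_mem_support h)
  | h₂ i j h hj =>
    have key : ∀ k, b.IsPos k → b.flip.IsPos k →
        (b.IsPos (P.reflectionPerm j k) ↔ b.flip.IsPos (P.reflectionPerm j k)) := by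
      intro k h1 h2
      by_cases hk : k = j
      · subst hk
        rw [isPos_reflectionPerm_self]
        exact (not_congr (iff_of_true h1 h2)).trans (isPos_reflectionPerm_self b.flip k).symm
      · exact iff_of_true (h1.reflectionPerm hj hk)
          (Base.IsPos.reflectionPerm (b := b.flip) h2 hj hk)
    by_cases hi : b.IsPos i
    · exact key i hi (h.mp hi)
    · have e : P.reflectionPerm j (P.reflectionPerm i i) =
          P.reflectionPerm (P.reflectionPerm j i) (P.reflectionPerm j i) :=
        smul_reflectionPerm_self (weylGroup.ofIdx P j) i
      have := key (P.reflectionPerm i i) ((isPos_reflectionPerm_self b i).mpr hi)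
        ((isPos_reflectionPerm_self b.flip i).mpr fun h' => hi (h.mpr h'))
      rw [e, isPos_reflectionPerm_self] at this
      exact not_iff_not.mp (this.trans (isPos_reflectionPerm_self b.flip _))

/-- A weight which is non-negative on the simple coroots is non-negative on all positive ones. -/
theorem toLinearMap_coroot_nonneg {ν : M}
    (hν : ∀ i ∈ b.support, 0 ≤ P.toLinearMap ν (P.coroot i)) {i : ι} (hi : b.IsPos i) :
    0 ≤ P.toLinearMap ν (P.coroot i) := by
  obtain ⟨f, -, hf, e⟩ := b.flip.exists_root_eq_sum_int i
  have hpos := (isPos_iff_isPos_flip b i).mp hi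
  rw [Base.isPos_iff, Base.height_eq_sum e] at hpos
  have hf' : 0 < f := by
    refine hf.resolve_right fun h => ?_
    exact absurd (Finset.sum_nonpos fun j _ => h.le j) hpos.not_ge
  change P.coroot i = ∑ j ∈ b.support, f j • P.coroot j at e
  rw [e, map_sum]
  refine Finset.sum_nonneg fun j hj => ?_
  rw [map_zsmul, zsmul_eq_mul]
  exact mul_nonneg (by exact_mod_cast hf'.le j) (hν j hj)

end Pos

/-! ### The Bruhat order on the Weyl group -/

/-- An elementary step `u < v` of the Bruhat order. -/
def BruhatStep (b : P.Base) (u v : P.weylGroup) : Prop :=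
  (∃ i : ι, v = weylGroup.ofIdx P i * u) ∧ length b u < length b v

theorem bruhatLE_refl (b : P.Base) (u : P.weylGroup) : bruhatLE b u u :=
  Relation.ReflTransGen.refl

theorem bruhatLE.trans {b : P.Base} {u v w : P.weylGroup} (h : bruhatLE b u v)
    (h' : bruhatLE b v w) : bruhatLE b u w :=
  Relation.ReflTransGen.trans h h'

theorem BruhatStep.le {b : P.Base} {u v : P.weylGroup} (h : BruhatStep b u v) : bruhatLE b u v :=
  Relation.ReflTransGen.single h

theorem bruhatLE.eq_or_length_lt {b : P.Base} {u v : P.weylGroup} (h : bruhatLE b u v) :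
    u = v ∨ length b u < length b v := by
  induction h with
  | refl => exact Or.inl rfl
  | tail _ h ih =>
    rcases ih with rfl | ih
    exacts [Or.inr h.2, Or.inr (ih.trans h.2)]

theorem bruhatLE.length_le {b : P.Base} {u v : P.weylGroup} (h : bruhatLE b u v) :
    length b u ≤ length b v := by
  rcases h.eq_or_length_lt with rfl | h
  exacts [le_rfl, h.le]

theorem bruhatLE.eq_of_length_le {b : P.Base} {u v : P.weylGroup} (h : bruhatLE b u v)
    (h' : length b v ≤ length b u) : u = v :=
  h.eq_or_length_lt.resolve_right h'.not_gt

theorem bruhatLE.antisymm {b : P.Base} {u v : P.weylGroup} (h : bruhatLE b u v)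
    (h' : bruhatLE b v u) : u = v :=
  h.eq_of_length_le h'.length_le

theorem bruhatLE_mul_right_of_lt {b : P.Base} {u : P.weylGroup} {i : ι}
    (h : length b u < length b (u * weylGroup.ofIdx P i)) :
    bruhatLE b u (u * weylGroup.ofIdx P i) :=
  BruhatStep.le ⟨⟨u • i, mul_ofIdx_eq u i⟩, h⟩

theorem mul_right_bruhatLE_of_lt {b : P.Base} {u : P.weylGroup} {i : ι}
    (h : length b (u * weylGroup.ofIdx P i) < length b u) :
    bruhatLE b (u * weylGroup.ofIdx P i) u := by
  have := bruhatLE_mul_right_of_lt (b := b) (u := u * weylGroup.ofIdx P i) (i := i)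
  simp only [mul_ofIdx_cancel_right] at this
  exact this h

theorem bruhatLE_mul_left_of_lt {b : P.Base} {u : P.weylGroup} {i : ι}
    (h : length b u < length b (weylGroup.ofIdx P i * u)) :
    bruhatLE b u (weylGroup.ofIdx P i * u) :=
  BruhatStep.le ⟨⟨i, rfl⟩, h⟩

theorem mul_left_bruhatLE_of_lt {b : P.Base} {u : P.weylGroup} {i : ι}
    (h : length b (weylGroup.ofIdx P i * u) < length b u) :
    bruhatLE b (weylGroup.ofIdx P i * u) u :=
  BruhatStep.le ⟨⟨i, by simp⟩, h⟩

/-! ### The lifting property for an abstract map `f`, to serve left and right multiplication alike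
-/

section Lifting

variable {b : P.Base} {f : P.weylGroup → P.weylGroup}
  (hf : ∀ u v, BruhatStep b u v → f u = v ∨ BruhatStep b (f u) (f v))

include hf

theorem map_bruhatLE_or {u v : P.weylGroup} (h : bruhatLE b u v) :
    bruhatLE b (f u) v ∨ bruhatLE b (f u) (f v) := by
  induction h with
  | refl => exact Or.inr (bruhatLE_refl b _)
  | @tail v w _ h ih =>
    rcases ih with ih | ih
    · exact Or.inl (ih.trans (BruhatStep.le h))
    · rcases hf v w h with h' | h'
      · exact Or.inl (h' ▸ ih)
      · exact Or.inr (ih.trans h'.le)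

theorem map_bruhatLE_map_or (hff : ∀ u, f (f u) = u) {u v : P.weylGroup} (h : bruhatLE b u v) :
    bruhatLE b (f u) (f v) ∨ bruhatLE b u (f v) := by
  induction h with
  | refl => exact Or.inl (bruhatLE_refl b _)
  | @tail v w huv h ih =>
    rcases hf v w h with h' | h'
    · right
      rw [← h', hff]
      exact huv
    · rcases ih with ih | ih
      exacts [Or.inl (ih.trans h'.le), Or.inr (ih.trans h'.le)]

end Lifting

/-! ### Simple reflections and the Bruhat order -/

section Weyl

variable [Finite ι] [P.IsCrystallographic] [P.IsReduced] {b : P.Base}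

theorem BruhatStep.exists_isPos {u v : P.weylGroup} (h : BruhatStep b u v) :
    ∃ i, b.IsPos i ∧ b.IsPos (u⁻¹ • i) ∧ v = weylGroup.ofIdx P i * u := by
  obtain ⟨⟨i, rfl⟩, h⟩ := h
  obtain ⟨j, hj, e⟩ := exists_isPos_ofIdx b i
  rw [← e] at h ⊢
  exact ⟨j, hj, (length_lt_ofIdx_mul_iff b hj u).mp h, rfl⟩

theorem BruhatStep.of_isPos {u : P.weylGroup} {i : ι} (hi : b.IsPos i) (h : b.IsPos (u⁻¹ • i)) :
    BruhatStep b u (weylGroup.ofIdx P i * u) :=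
  ⟨⟨i, rfl⟩, lt_length_ofIdx_mul b hi h⟩

/-- With v = s_β u, the simple reflection keeps u⁻¹β positive unless u⁻¹β is its own root; in that
case u s_i = s_β u = v. -/
theorem BruhatStep.mul_right {u v : P.weylGroup} (h : BruhatStep b u v) {i : ι}
    (hi : i ∈ b.support) : u * weylGroup.ofIdx P i = v ∨
      BruhatStep b (u * weylGroup.ofIdx P i) (v * weylGroup.ofIdx P i) := by
  obtain ⟨j, hj, hu, rfl⟩ := h.exists_isPos
  by_cases hij : u⁻¹ • j = i
  · left
    rw [← hij, mul_ofIdx_eq, smul_inv_smul]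
  · right
    rw [mul_assoc]
    refine .of_isPos hj ?_
    rw [mul_inv_rev, mul_smul, ofIdx_inv]
    exact hu.reflectionPerm hi hij

theorem BruhatStep.mul_left {u v : P.weylGroup} (h : BruhatStep b u v) {i : ι}
    (hi : i ∈ b.support) : weylGroup.ofIdx P i * u = v ∨
      BruhatStep b (weylGroup.ofIdx P i * u) (weylGroup.ofIdx P i * v) := by
  obtain ⟨j, hj, hu, rfl⟩ := h.exists_isPos
  by_cases hij : j = i
  · left
    rw [hij]
  · right
    have e : weylGroup.ofIdx P i * (weylGroup.ofIdx P j * u) =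
        weylGroup.ofIdx P (weylGroup.ofIdx P i • j) * (weylGroup.ofIdx P i * u) := by
      rw [ofIdx_smul_conj]; group
    rw [e]
    refine .of_isPos (hj.reflectionPerm hi hij) ?_
    rwa [mul_inv_rev, mul_smul, inv_smul_smul]

theorem mul_right_le_or {u v : P.weylGroup} (h : bruhatLE b u v) {i : ι} (hi : i ∈ b.support) :
    bruhatLE b (u * weylGroup.ofIdx P i) v ∨
      bruhatLE b (u * weylGroup.ofIdx P i) (v * weylGroup.ofIdx P i) :=
  map_bruhatLE_or (f := (· * weylGroup.ofIdx P i)) (fun _ _ h => h.mul_right hi) h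

theorem mul_right_le_mul_right_or {u v : P.weylGroup} (h : bruhatLE b u v) {i : ι}
    (hi : i ∈ b.support) :
    bruhatLE b (u * weylGroup.ofIdx P i) (v * weylGroup.ofIdx P i) ∨
      bruhatLE b u (v * weylGroup.ofIdx P i) :=
  map_bruhatLE_map_or (f := (· * weylGroup.ofIdx P i)) (fun _ _ h => h.mul_right hi) (by simp) h

theorem mul_left_le_or {u v : P.weylGroup} (h : bruhatLE b u v) {i : ι} (hi : i ∈ b.support) :
    bruhatLE b (weylGroup.ofIdx P i * u) v ∨
      bruhatLE b (weylGroup.ofIdx P i * u) (weylGroup.ofIdx P i * v) :=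
  map_bruhatLE_or (f := (weylGroup.ofIdx P i * ·)) (fun _ _ h => h.mul_left hi) h

theorem mul_left_le_mul_left_or {u v : P.weylGroup} (h : bruhatLE b u v) {i : ι}
    (hi : i ∈ b.support) :
    bruhatLE b (weylGroup.ofIdx P i * u) (weylGroup.ofIdx P i * v) ∨
      bruhatLE b u (weylGroup.ofIdx P i * v) :=
  map_bruhatLE_map_or (f := (weylGroup.ofIdx P i * ·)) (fun _ _ h => h.mul_left hi) (by simp) h

theorem mul_right_le_of_lt {u v : P.weylGroup} (h : bruhatLE b u v) {i : ι} (hi : i ∈ b.support)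
    (hv : length b (v * weylGroup.ofIdx P i) < length b v) :
    bruhatLE b (u * weylGroup.ofIdx P i) v :=
  (mul_right_le_or h hi).elim id fun h' => h'.trans (mul_right_bruhatLE_of_lt hv)

theorem le_mul_right_of_lt {u v : P.weylGroup} (h : bruhatLE b u v) {i : ι} (hi : i ∈ b.support)
    (hu : length b u < length b (u * weylGroup.ofIdx P i)) :
    bruhatLE b u (v * weylGroup.ofIdx P i) :=
  (mul_right_le_mul_right_or h hi).elim (fun h' => (bruhatLE_mul_right_of_lt hu).trans h') id

theorem mul_right_le_mul_right_of_lt {u v : P.weylGroup} (h : bruhatLE b u v) {i : ι}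
    (hi : i ∈ b.support) (hu : length b (u * weylGroup.ofIdx P i) < length b u) :
    bruhatLE b (u * weylGroup.ofIdx P i) (v * weylGroup.ofIdx P i) :=
  (mul_right_le_mul_right_or h hi).elim id fun h' => (mul_right_bruhatLE_of_lt hu).trans h'

theorem mul_left_le_of_lt {u v : P.weylGroup} (h : bruhatLE b u v) {i : ι} (hi : i ∈ b.support)
    (hv : length b (weylGroup.ofIdx P i * v) < length b v) :
    bruhatLE b (weylGroup.ofIdx P i * u) v :=
  (mul_left_le_or h hi).elim id fun h' => h'.trans (mul_left_bruhatLE_of_lt hv)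

theorem mul_left_le_mul_left_of_gt {u v : P.weylGroup} (h : bruhatLE b u v) {i : ι}
    (hi : i ∈ b.support) (hv : length b v < length b (weylGroup.ofIdx P i * v)) :
    bruhatLE b (weylGroup.ofIdx P i * u) (weylGroup.ofIdx P i * v) :=
  (mul_left_le_or h hi).elim (fun h' => h'.trans (bruhatLE_mul_left_of_lt hv)) id

theorem length_ofIdx_mul_ne (i : ι) (u : P.weylGroup) :
    length b (weylGroup.ofIdx P i * u) ≠ length b u := by
  obtain ⟨j, hj, e⟩ := exists_isPos_ofIdx b i
  rw [← e]
  by_cases h : b.IsPos (u⁻¹ • j)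
  exacts [(lt_length_ofIdx_mul b hj h).ne', (length_ofIdx_mul_lt b hj h).ne]

theorem length_mul_ofIdx_ne (i : ι) (u : P.weylGroup) :
    length b (u * weylGroup.ofIdx P i) ≠ length b u := by
  rw [mul_ofIdx_eq]
  exact length_ofIdx_mul_ne _ u

theorem length_ofIdx_mul_le {i : ι} (hi : i ∈ b.support) (u : P.weylGroup) :
    length b (weylGroup.ofIdx P i * u) ≤ length b u + 1 := by
  obtain ⟨l, hl, hlen, rfl⟩ := exists_reduced b u
  have := length_prod_le b (l := i :: l) (by simpa [hi] using hl)
  simpa [← hlen] using this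

theorem length_le_ofIdx_mul {i : ι} (hi : i ∈ b.support) (u : P.weylGroup) :
    length b u ≤ length b (weylGroup.ofIdx P i * u) + 1 := by
  simpa using length_ofIdx_mul_le hi (weylGroup.ofIdx P i * u)

theorem exists_mul_ofIdx_lt {w : P.weylGroup} (hw : w ≠ 1) :
    ∃ i ∈ b.support, length b (w * weylGroup.ofIdx P i) < length b w := by
  obtain ⟨l, hl, hlen, rfl⟩ := exists_reduced b w
  rcases l.eq_nil_or_concat with rfl | ⟨l, i, rfl⟩
  · simp at hw
  · refine ⟨i, hl i (by simp), ?_⟩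
    have := length_prod_le b (l := l) fun j hj => hl j (by simp [hj])
    rw [← hlen]
    simp only [List.concat_eq_append, List.map_append, List.map_cons, List.map_nil,
      List.prod_append, List.prod_cons, List.prod_nil, mul_one, mul_ofIdx_cancel_right,
      List.length_append, List.length_cons, List.length_nil]
    omega

theorem exists_ofIdx_mul_lt {w : P.weylGroup} (hw : w ≠ 1) :
    ∃ i ∈ b.support, length b (weylGroup.ofIdx P i * w) < length b w := by
  obtain ⟨l, hl, hlen, rfl⟩ := exists_reduced b w
  rcases l with _ | ⟨i, l⟩
  · simp at hw
  · refine ⟨i, hl i (by simp), ?_⟩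
    have := length_prod_le b (l := l) fun j hj => hl j (by simp [hj])
    rw [← hlen]
    simp only [List.map_cons, List.prod_cons, ofIdx_mul_cancel_left, List.length_cons]
    omega

theorem one_bruhatLE (w : P.weylGroup) : bruhatLE b 1 w := by
  induction hn : length b w using Nat.strong_induction_on generalizing w with
  | _ n ih =>
    by_cases hw : w = 1
    · rw [hw]; exact bruhatLE_refl b 1
    · obtain ⟨i, hi, h⟩ := exists_ofIdx_mul_lt (b := b) hw
      exact (ih _ (hn ▸ h) _ rfl).trans (mul_left_bruhatLE_of_lt h)

/-! ### Stabilizers of dominant weights -/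

omit [Finite ι] [P.IsCrystallographic] [P.IsReduced] in
theorem ofIdx_mem_stab_iff {ν : M} {i : ι} :
    weylGroup.ofIdx P i ∈ stab P ν ↔ P.toLinearMap ν (P.coroot i) = 0 := by
  rw [MulAction.mem_stabilizer_iff, ofIdx_smul_eq, sub_eq_self, smul_eq_zero]
  exact or_iff_left (P.ne_zero i)

theorem IsDominantWeight.nonneg {ν : M} (hν : IsDominantWeight b ν) {i : ι} (hi : b.IsPos i) :
    0 ≤ P.toLinearMap ν (P.coroot i) :=
  toLinearMap_coroot_nonneg b hν.2 hi

theorem IsDominantWeight.nonpos {ν : M} (hν : IsDominantWeight b ν) {i : ι} (hi : ¬ b.IsPos i) :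
    P.toLinearMap ν (P.coroot i) ≤ 0 := by
  have := hν.nonneg ((isPos_reflectionPerm_self b i).mpr hi)
  rw [coroot_reflectionPerm, coreflection_apply_self, map_neg] at this
  linarith

/-- Any right descent of w works: w sends its simple root α to a negative root, so ⟨ν, α^∨⟩ = ⟨wν,
(wα)^∨⟩ ≤ 0, and dominance forces 0. Hence W_ν is generated by simple reflections, which
`stab_induction` exploits. -/
theorem exists_mul_ofIdx_lt_of_mem_stab {ν : M} (hν : IsDominantWeight b ν) {w : P.weylGroup}
    (hw : w ∈ stab P ν) (hw1 : w ≠ 1) : ∃ i ∈ b.support, weylGroup.ofIdx P i ∈ stab P ν ∧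
      length b (w * weylGroup.ofIdx P i) < length b w := by
  obtain ⟨i, hi, h⟩ := exists_mul_ofIdx_lt (b := b) hw1
  refine ⟨i, hi, ?_, h⟩
  have hneg : ¬ b.IsPos (w • i) := fun h' => by
    rw [mul_ofIdx_eq] at h
    refine absurd (lt_length_ofIdx_mul b h' ?_) h.not_gt
    rw [inv_smul_smul]
    exact b.isPos_of_mem_support hi
  have h1 := hν.nonpos hneg
  rw [← MulAction.mem_stabilizer_iff.mp hw, toLinearMap_smul_coroot] at h1
  exact ofIdx_mem_stab_iff.mpr (le_antisymm h1 (hν.2 i hi))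

theorem stab_induction {ν : M} (hν : IsDominantWeight b ν) {p : P.weylGroup → Prop} (one : p 1)
    (mul : ∀ w ∈ stab P ν, ∀ i ∈ b.support, weylGroup.ofIdx P i ∈ stab P ν → p w →
      p (w * weylGroup.ofIdx P i)) {w : P.weylGroup} (hw : w ∈ stab P ν) : p w := by
  induction hn : length b w using Nat.strong_induction_on generalizing w with
  | _ n ih =>
    by_cases hw1 : w = 1
    · rwa [hw1]
    · obtain ⟨i, hi, his, h⟩ := exists_mul_ofIdx_lt_of_mem_stab hν hw hw1
      have hm := mul_mem hw his
      have := mul _ hm i hi his (ih _ (hn ▸ h) hm rfl)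
      rwa [mul_ofIdx_cancel_right] at this

theorem stab_le_stab {ν μ : M} (hν : IsDominantWeight b ν)
    (h : ∀ i ∈ b.support, P.toLinearMap ν (P.coroot i) = 0 → P.toLinearMap μ (P.coroot i) = 0) :
    stab P ν ≤ stab P μ := by
  intro w hw
  refine stab_induction hν (one_mem _) (fun w _ i hi his hw => mul_mem hw ?_) hw
  exact ofIdx_mem_stab_iff.mpr (h i hi (ofIdx_mem_stab_iff.mp his))

omit [Finite ι] [P.IsCrystallographic] [P.IsReduced] in
theorem IsDominantWeight.zero : IsDominantWeight b (0 : M) :=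
  ⟨fun _ => ⟨0, by simp⟩, fun _ _ => by simp⟩

omit [Finite ι] [P.IsCrystallographic] [P.IsReduced] in
theorem IsDominantWeight.add {ν μ : M} (hν : IsDominantWeight b ν) (hμ : IsDominantWeight b μ) :
    IsDominantWeight b (ν + μ) := by
  refine ⟨fun i => ?_, fun i hi => ?_⟩
  · obtain ⟨x, hx⟩ := hν.1 i
    obtain ⟨y, hy⟩ := hμ.1 i
    exact ⟨x + y, by simp [hx, hy]⟩
  · rw [map_add, LinearMap.add_apply]
    exact add_nonneg (hν.2 i hi) (hμ.2 i hi)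

omit [Finite ι] [P.IsCrystallographic] [P.IsReduced] in
theorem IsDominantWeight.sum {α : Type*} {s : Finset α} {f : α → M}
    (h : ∀ a ∈ s, IsDominantWeight b (f a)) : IsDominantWeight b (∑ a ∈ s, f a) :=
  Finset.sum_induction f (IsDominantWeight b) (fun _ _ => .add) .zero h

theorem stab_sum_le {α : Type*} {s : Finset α} {f : α → M}
    (h : ∀ a ∈ s, IsDominantWeight b (f a)) {a : α} (ha : a ∈ s) :
    stab P (∑ a ∈ s, f a) ≤ stab P (f a) := by
  refine stab_le_stab (.sum h) fun i hi e => ?_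
  rw [map_sum, LinearMap.sum_apply] at e
  exact (Finset.sum_eq_zero_iff_of_nonneg fun a ha => (h a ha).2 i hi).mp e a ha

theorem stab_add_le_left {ν μ : M} (hν : IsDominantWeight b ν) (hμ : IsDominantWeight b μ) :
    stab P (ν + μ) ≤ stab P ν := by
  refine stab_le_stab (hν.add hμ) fun i hi e => ?_
  rw [map_add, LinearMap.add_apply] at e
  linarith [hν.2 i hi, hμ.2 i hi]

theorem stab_add_le_right {ν μ : M} (hν : IsDominantWeight b ν) (hμ : IsDominantWeight b μ) :
    stab P (ν + μ) ≤ stab P μ := by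
  rw [add_comm]
  exact stab_add_le_left hμ hν

/-! ### Cosets -/

omit [Finite ι] [P.IsCrystallographic] [P.IsReduced] in
theorem mk_eq_mk_iff {ν : M} {u v : P.weylGroup} :
    (u : Cosets P ν) = (v : Cosets P ν) ↔ u • ν = v • ν := by
  rw [QuotientGroup.eq, MulAction.mem_stabilizer_iff, mul_smul, inv_smul_eq_iff, eq_comm]

omit [Finite ι] [P.IsCrystallographic] [P.IsReduced] in
theorem mk_mul_of_mem {ν : M} {w : P.weylGroup} (hw : w ∈ stab P ν) (u : P.weylGroup) :
    ((u * w : P.weylGroup) : Cosets P ν) = (u : Cosets P ν) :=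
  QuotientGroup.mk_mul_of_mem u hw

omit [Finite ι] [P.IsCrystallographic] [P.IsReduced] in
theorem mk_mul_left_iff {ν : M} {w u v : P.weylGroup} :
    ((w * u : P.weylGroup) : Cosets P ν) = ((w * v : P.weylGroup) : Cosets P ν) ↔
      (u : Cosets P ν) = (v : Cosets P ν) := by
  rw [mk_eq_mk_iff, mk_eq_mk_iff, mul_smul, mul_smul, smul_left_cancel_iff]

/-- `u` is shorter than `u s` for all simple reflections `s` which fix `ν`. -/
def IsReducedRep (b : P.Base) (ν : M) (u : P.weylGroup) : Prop :=
  ∀ i ∈ b.support, weylGroup.ofIdx P i ∈ stab P ν →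
    length b u < length b (u * weylGroup.ofIdx P i)

/-- The lifting property preserves u ≤ v when v is multiplied by a simple reflection that lengthens
u. This promotes a condition on simple reflections to minimality in the whole coset. -/
theorem IsReducedRep.le_mul {ν : M} (hν : IsDominantWeight b ν) {u v w : P.weylGroup}
    (hu : IsReducedRep b ν u) (h : bruhatLE b u v) (hw : w ∈ stab P ν) : bruhatLE b u (v * w) := by
  refine stab_induction hν (p := fun w => bruhatLE b u (v * w)) (by simpa) ?_ hw
  intro w _ i hi his h
  rw [← mul_assoc]
  exact le_mul_right_of_lt h hi (hu i hi his)

theorem IsReducedRep.le_of_mk_eq {ν : M} (hν : IsDominantWeight b ν) {u v v' : P.weylGroup}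
    (hu : IsReducedRep b ν u) (h : bruhatLE b u v) (e : (v : Cosets P ν) = v') :
    bruhatLE b u v' := by
  simpa using hu.le_mul hν h (QuotientGroup.eq.mp e)

theorem IsReducedRep.isMinRep {ν : M} (hν : IsDominantWeight b ν) {u : P.weylGroup}
    (hu : IsReducedRep b ν u) : IsMinRep b u (u : Cosets P ν) :=
  ⟨rfl, fun _ h => hu.le_of_mk_eq hν (bruhatLE_refl b u) h.symm⟩

theorem IsReducedRep.length_le {ν : M} (hν : IsDominantWeight b ν) {u v : P.weylGroup}
    (hu : IsReducedRep b ν u) (h : (v : Cosets P ν) = u) : length b u ≤ length b v :=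
  ((hu.isMinRep hν).2 v h).length_le

theorem IsReducedRep.eq {ν : M} (hν : IsDominantWeight b ν) {u v : P.weylGroup}
    (hu : IsReducedRep b ν u) (hv : IsReducedRep b ν v) (h : (u : Cosets P ν) = v) : u = v :=
  ((hu.isMinRep hν).2 v h.symm).antisymm ((hv.isMinRep hν).2 u h)

theorem exists_isReducedRep {ν : M} (θ : Cosets P ν) :
    ∃ u : P.weylGroup, (u : Cosets P ν) = θ ∧ IsReducedRep b ν u := by
  obtain ⟨u, hu⟩ := QuotientGroup.mk_surjective θ
  induction hn : length b u using Nat.strong_induction_on generalizing u with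
  | _ n ih =>
    by_cases h : IsReducedRep b ν u
    · exact ⟨u, hu, h⟩
    · simp only [IsReducedRep, not_forall, not_lt] at h
      obtain ⟨i, hi, his, h⟩ := h
      exact ih _ (hn ▸ h.lt_of_ne (length_mul_ofIdx_ne i u)) (u * weylGroup.ofIdx P i)
        (by rw [mk_mul_of_mem his, hu]) rfl

theorem IsReducedRep.cosetLE_iff {ν : M} (hν : IsDominantWeight b ν) {u v : P.weylGroup}
    (hu : IsReducedRep b ν u) : cosetLE b (u : Cosets P ν) (v : Cosets P ν) ↔ bruhatLE b u v := by
  refine ⟨?_, fun h => ⟨u, v, rfl, rfl, h⟩⟩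
  rintro ⟨u', v', hu', hv', h⟩
  exact hu.le_of_mk_eq hν (((hu.isMinRep hν).2 u' hu').trans h) hv'

omit [Finite ι] [P.IsCrystallographic] [P.IsReduced] in
theorem bruhatLE.cosetLE {ν : M} {u v : P.weylGroup} (h : bruhatLE b u v) :
    cosetLE b (u : Cosets P ν) (v : Cosets P ν) :=
  ⟨u, v, rfl, rfl, h⟩

omit [Finite ι] [P.IsCrystallographic] [P.IsReduced] in
theorem cosetLE_refl {ν : M} (θ : Cosets P ν) : cosetLE b θ θ := by
  obtain ⟨u, rfl⟩ := QuotientGroup.mk_surjective θ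
  exact (bruhatLE_refl b u).cosetLE

/-- The representatives of φ in the two hypotheses may differ; minimal representatives make them
match. -/
theorem cosetLE_trans {ν : M} (hν : IsDominantWeight b ν) {θ φ ψ : Cosets P ν}
    (h : cosetLE b θ φ) (h' : cosetLE b φ ψ) : cosetLE b θ ψ := by
  obtain ⟨u, rfl, hu⟩ := exists_isReducedRep (b := b) θ
  obtain ⟨v, rfl, hv⟩ := exists_isReducedRep (b := b) φ
  obtain ⟨w, rfl⟩ := QuotientGroup.mk_surjective ψ
  exact (((hu.cosetLE_iff hν).mp h).trans ((hv.cosetLE_iff hν).mp h')).cosetLE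

theorem cosetLE_antisymm {ν : M} (hν : IsDominantWeight b ν) {θ φ : Cosets P ν}
    (h : cosetLE b θ φ) (h' : cosetLE b φ θ) : θ = φ := by
  obtain ⟨u, rfl, hu⟩ := exists_isReducedRep (b := b) θ
  obtain ⟨v, rfl, hv⟩ := exists_isReducedRep (b := b) φ
  rw [((hu.cosetLE_iff hν).mp h).antisymm ((hv.cosetLE_iff hν).mp h')]

theorem one_cosetLE {ν : M} (θ : Cosets P ν) : cosetLE b ((1 : P.weylGroup) : Cosets P ν) θ := by
  obtain ⟨u, rfl⟩ := QuotientGroup.mk_surjective θ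
  exact (one_bruhatLE u).cosetLE

omit [Finite ι] [P.IsCrystallographic] [P.IsReduced] in
theorem proj_cosetLE {ν μ : M} (h : stab P ν ≤ stab P μ) {θ φ : Cosets P ν}
    (hle : cosetLE b θ φ) : cosetLE b (proj μ θ) (proj μ φ) := by
  obtain ⟨u, v, rfl, rfl, huv⟩ := hle
  rw [proj_mk h, proj_mk h]
  exact huv.cosetLE

omit [Finite ι] [P.IsCrystallographic] [P.IsReduced] in
theorem proj_proj {ν μ κ : M} (h : stab P ν ≤ stab P μ) (h' : stab P μ ≤ stab P κ)
    (θ : Cosets P ν) : proj κ (proj μ θ) = proj κ θ := by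
  obtain ⟨u, rfl⟩ := QuotientGroup.mk_surjective θ
  rw [proj_mk h, proj_mk h', proj_mk (h.trans h')]

instance finite_weylGroup [P.IsRootSystem] : Finite P.weylGroup := by
  refine Finite.of_injective (fun (w : P.weylGroup) (i : ι) => w • i) fun u v h => ?_
  apply Subtype.ext
  apply Equiv.weightHom_injective P
  apply LinearEquiv.toLinearMap_injective
  refine LinearMap.ext_on (IsRootSystem.span_root_eq_top (P := P)) ?_
  rintro _ ⟨i, rfl⟩
  change u • P.root i = v • P.root i
  rw [← root_smul, ← root_smul]
  exact congrArg P.root (congrFun h i)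

/-- A representative of greatest length has all simple reflections of W_ν as right descents, so the
lifting property keeps its coset below it. -/
theorem exists_maxRep [P.IsRootSystem] {ν : M} (hν : IsDominantWeight b ν) (θ : Cosets P ν) :
    ∃ u : P.weylGroup, (u : Cosets P ν) = θ ∧
      ∀ v : P.weylGroup, (v : Cosets P ν) = θ → bruhatLE b v u := by
  obtain ⟨u, hu, hmax⟩ := Set.exists_max_image {u : P.weylGroup | (u : Cosets P ν) = θ} (length b)
    (Set.toFinite _) (QuotientGroup.mk_surjective θ)
  refine ⟨u, hu, fun v hv => ?_⟩
  have hw : u⁻¹ * v ∈ stab P ν := QuotientGroup.eq.mp (hu.trans hv.symm)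
  have : bruhatLE b (u * (u⁻¹ * v)) u := by
    refine stab_induction hν (p := fun w => bruhatLE b (u * w) u)
      (by simpa using bruhatLE_refl b u) ?_ hw
    intro w _ i hi his h
    rw [← mul_assoc]
    refine mul_right_le_of_lt h hi (lt_of_le_of_ne ?_ (length_mul_ofIdx_ne i u))
    exact hmax _ ((mk_mul_of_mem his u).trans hu)
  simpa using this

end Weyl

/-! ### Covering relations of cosets -/

section Cover

variable [Finite ι] [P.IsCrystallographic] [P.IsReduced] {b : P.Base} {ν : M}

theorem cosetLT_of_mul_left_lt (hν : IsDominantWeight b ν) {v : P.weylGroup} {i : ι}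
    (hv : IsReducedRep b ν v) (h : length b (weylGroup.ofIdx P i * v) < length b v) :
    cosetLT b ((weylGroup.ofIdx P i * v : P.weylGroup) : Cosets P ν) (v : Cosets P ν) :=
  ⟨(mul_left_bruhatLE_of_lt h).cosetLE, fun e => absurd (hv.length_le hν e) h.not_ge⟩

theorem IsReducedRep.mul_left {v : P.weylGroup} {i : ι} (hi : i ∈ b.support)
    (hv : IsReducedRep b ν v) (h : length b (weylGroup.ofIdx P i * v) < length b v) :
    IsReducedRep b ν (weylGroup.ofIdx P i * v) := by
  intro j hj hjs
  have h1 := hv j hj hjs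
  have h2 := length_le_ofIdx_mul hi (v * weylGroup.ofIdx P j)
  rw [← mul_assoc] at h2
  have h3 := length_mul_ofIdx_ne (b := b) j (weylGroup.ofIdx P i * v)
  omega

/-- If `θ' ⋖ θ`, then an element of `θ'` below the minimal representative of `θ` is the minimal
representative of `θ'`. -/
theorem isReducedRep_of_covBy (hν : IsDominantWeight b ν) {v z : P.weylGroup}
    (hv : IsReducedRep b ν v) (hcov : cosetCovBy b (z : Cosets P ν) (v : Cosets P ν))
    (hzv : bruhatLE b z v) : IsReducedRep b ν z := by
  induction hn : length b v using Nat.strong_induction_on generalizing v z with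
  | _ n ih =>
    subst hn
    have hne : z ≠ v := fun e => hcov.1.2 (by rw [e])
    have hv1 : v ≠ 1 := fun e => by
      subst e
      exact hne (hzv.antisymm (one_bruhatLE z))
    obtain ⟨i, hi, hlt⟩ := exists_ofIdx_mul_lt (b := b) hv1
    set r := weylGroup.ofIdx P i with hr
    have hrv := hv.mul_left hi hlt
    have hltc := cosetLT_of_mul_left_lt hν hv hlt
    -- If the coset of z lies below that of r v, the cover makes them equal; then r v ≤ z < v leaves
    -- room only for z = r v.
    by_cases hcase : cosetLE b (z : Cosets P ν) ((r * v : P.weylGroup) : Cosets P ν)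
    · have e : (z : Cosets P ν) = ((r * v : P.weylGroup) : Cosets P ν) := by
        by_contra hne'
        exact hcov.2 _ ⟨hcase, hne'⟩ hltc
      have h1 := (hrv.isMinRep hν).2 z e
      have h2 := hzv.eq_or_length_lt.resolve_left hne
      have h3 := length_le_ofIdx_mul hi v
      rw [← h1.eq_of_length_le (by omega)]
      exact hrv
    -- Otherwise r is also a left descent of z, and multiplication by r turns the cover into one
    -- with the shorter top r v, to which induction applies.
    · have hnle : ¬ bruhatLE b z (r * v) := fun h => hcase h.cosetLE
      have hrz : bruhatLE b (r * z) (r * v) := (mul_left_le_mul_left_or hzv hi).resolve_right hnle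
      have hrzlt : length b (r * z) < length b z := by
        by_contra hge
        have hlt' : length b z < length b (r * z) :=
          lt_of_le_of_ne (not_lt.mp hge) (length_ofIdx_mul_ne i z).symm
        exact hnle ((bruhatLE_mul_left_of_lt hlt').trans hrz)
      have hcov' : cosetCovBy b ((r * z : P.weylGroup) : Cosets P ν)
          ((r * v : P.weylGroup) : Cosets P ν) := by
        refine ⟨⟨hrz.cosetLE, fun e => hcov.1.2 (mk_mul_left_iff.mp e)⟩, fun ψ h1 h2 => ?_⟩
        obtain ⟨c, rfl, hc⟩ := exists_isReducedRep (b := b) ψ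
        obtain ⟨g, hg, hg'⟩ := exists_isReducedRep (b := b) ((r * z : P.weylGroup) : Cosets P ν)
        have hcv : bruhatLE b c (r * v) := (hc.cosetLE_iff hν).mp h2.1
        have hgc : bruhatLE b g c := (hg'.cosetLE_iff hν).mp (hg ▸ h1.1)
        have hz : ((r * g : P.weylGroup) : Cosets P ν) = z := by
          rw [← mk_mul_left_iff (w := r), ← mul_assoc, hr, ofIdx_mul_self, one_mul, hg]
        rcases lt_or_gt_of_ne (length_ofIdx_mul_ne (b := b) i c) with hl | hl
        · exact hcase (cosetLE_trans hν (hz ▸ (mul_left_le_of_lt hgc hi hl).cosetLE) h2.1)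
        · have h3 : bruhatLE b (r * g) (r * c) := mul_left_le_mul_left_of_gt hgc hi hl
          have h4 : bruhatLE b (r * c) v := by
            have := mul_left_le_mul_left_of_gt hcv hi (by simpa [hr] using hlt)
            simpa [hr] using this
          refine hcov.2 ((r * c : P.weylGroup) : Cosets P ν) ⟨hz ▸ h3.cosetLE, fun e => ?_⟩
            ⟨h4.cosetLE, fun e => ?_⟩
          · refine h1.2 ?_
            rw [← hz, mk_mul_left_iff] at e
            rw [← e, hg]
          · refine h2.2 ?_
            rw [← mk_mul_left_iff (w := r), ← mul_assoc, hr, ofIdx_mul_self, one_mul, ← hr, e]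
      have hrzr : IsReducedRep b ν (r * z) := ih _ hlt hrv hcov' hrz rfl
      -- Suppose z s < z with s = s_j in W_ν. The lifting property leaves r z s = z, which merges
      -- the cosets of r z and z, or r z s ≤ r z, which contradicts that r z is reduced.
      intro j hj hjs
      by_contra hge
      have hlt' : length b (z * weylGroup.ofIdx P j) < length b z :=
        lt_of_le_of_ne (not_lt.mp hge) (length_mul_ofIdx_ne j z)
      have h1 := hrzr j hj hjs
      rw [mul_assoc] at h1
      have h2 := length_le_ofIdx_mul hi z
      rw [← hr] at h2
      rcases mul_left_le_or (mul_right_bruhatLE_of_lt hlt') hi with h | h <;> rw [← hr] at h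
      · have e := h.eq_of_length_le (by omega)
        refine hcase ?_
        have : ((r * z : P.weylGroup) : Cosets P ν) = z := by
          rw [← mk_mul_of_mem hjs (r * z), mul_assoc]
          exact congrArg _ e
        rw [← this]
        exact hrz.cosetLE
      · exact absurd h.length_le h1.not_ge

/-- If `θ' ⋖ θ`, there is an involution `t` which maps `θ` to `θ'` downwards, such that `w' ≤ w`
with `w' ∈ θ'`, `w ∈ θ` implies both `w' ≤ t w` and `t w' ≤ w`. -/
theorem exists_involution_of_covBy (hν : IsDominantWeight b ν) {θ' θ : Cosets P ν}
    (hcov : cosetCovBy b θ' θ) : ∃ t : P.weylGroup, t * t = 1 ∧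
      (∀ w : P.weylGroup, (w : Cosets P ν) = θ →
        ((t * w : P.weylGroup) : Cosets P ν) = θ' ∧ bruhatLE b (t * w) w) ∧
      ∀ w w' : P.weylGroup, (w : Cosets P ν) = θ → (w' : Cosets P ν) = θ' → bruhatLE b w' w →
        bruhatLE b w' (t * w) ∧ bruhatLE b (t * w') w := by
  obtain ⟨v, rfl, hv⟩ := exists_isReducedRep (b := b) θ
  obtain ⟨c, rfl, hc⟩ := exists_isReducedRep (b := b) θ'
  have hcv : bruhatLE b c v := (hc.cosetLE_iff hν).mp hcov.1.1
  -- The reflection t is the last step of a Bruhat chain from min θ' to min θ.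
  obtain ⟨i, hipos, hic, hilt⟩ : ∃ i, b.IsPos i ∧ bruhatLE b c (weylGroup.ofIdx P i * v) ∧
      length b (weylGroup.ofIdx P i * v) < length b v := by
    rcases Relation.ReflTransGen.cases_tail hcv with e | ⟨y, hy, hstep⟩
    · exact absurd (by rw [e]) hcov.1.2
    · obtain ⟨i, hi, -, rfl⟩ := BruhatStep.exists_isPos hstep
      exact ⟨i, hi, by rwa [ofIdx_mul_cancel_left], by simpa using hstep.2⟩
  set t := weylGroup.ofIdx P i with ht
  have htt : ∀ w, t * (t * w) = w := fun w => by simp [ht]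
  have htv : ((t * v : P.weylGroup) : Cosets P ν) = (c : Cosets P ν) := by
    by_contra hne
    exact hcov.2 _ ⟨hic.cosetLE, fun e => hne e.symm⟩ (cosetLT_of_mul_left_lt hν hv hilt)
  have hdown : ∀ w : P.weylGroup, (w : Cosets P ν) = v →
      ((t * w : P.weylGroup) : Cosets P ν) = c ∧ bruhatLE b (t * w) w := by
    intro w hw
    refine ⟨by rw [← htv, mk_mul_left_iff, hw], mul_left_bruhatLE_of_lt ?_⟩
    -- If w⁻¹β were positive, ⟨wν, β^∨⟩ = ⟨vν, β^∨⟩ would be both ≥ 0 and ≤ 0; then t fixes vν and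
    -- θ' = θ.
    refine length_ofIdx_mul_lt b hipos fun hpos => ?_
    have h1 := hν.nonneg hpos
    have h2 := hν.nonpos ((length_ofIdx_mul_lt_iff b hipos v).mp hilt)
    rw [← toLinearMap_smul_coroot', mk_eq_mk_iff.mp hw] at h1
    rw [← toLinearMap_smul_coroot'] at h2
    refine hcov.1.2 ?_
    rw [← htv, mk_eq_mk_iff, mul_smul, ht, ofIdx_smul_eq, le_antisymm h2 h1, zero_smul, sub_zero]
  refine ⟨t, by simp [ht], hdown, fun w w' hw hw' hle => ?_⟩
  induction hn : length b w using Nat.strong_induction_on generalizing w w' with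
  | _ n ih =>
    subst hn
    by_cases hmin : IsReducedRep b ν w
    · obtain rfl := hmin.eq hν hv hw
      have h1 : IsReducedRep b ν w' := isReducedRep_of_covBy hν hmin (hw'.symm ▸ hcov) hle
      have h2 : IsReducedRep b ν (t * w) :=
        isReducedRep_of_covBy hν hmin (htv.symm ▸ hcov) (mul_left_bruhatLE_of_lt hilt)
      obtain rfl := h1.eq hν h2 (hw'.trans htv.symm)
      rw [htt]
      exact ⟨bruhatLE_refl b _, bruhatLE_refl b _⟩
    · simp only [IsReducedRep, not_forall, not_lt] at hmin
      obtain ⟨j, hj, hjs, hge⟩ := hmin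
      set s := weylGroup.ofIdx P j with hs
      have hlt : length b (w * s) < length b w := lt_of_le_of_ne hge (length_mul_ofIdx_ne j w)
      have hws : ((w * s : P.weylGroup) : Cosets P ν) = v := (mk_mul_of_mem hjs w).trans hw
      -- If t w < t w s, then t w ≤ w s, and the induction hypothesis for this pair gives w ≤ w s,
      -- which is absurd.
      have hsle : bruhatLE b (t * (w * s)) (t * w) := by
        rw [← mul_assoc]
        refine mul_right_bruhatLE_of_lt (lt_of_le_of_ne ?_ (length_mul_ofIdx_ne j _))
        by_contra hgt
        have h1 : bruhatLE b (t * w) (w * s) := by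
          refine (bruhatLE_mul_right_of_lt (not_le.mp hgt)).trans ?_
          rw [mul_assoc]
          exact (hdown _ hws).2
        have h2 := (ih _ hlt _ (t * w) hws (hdown w hw).1 h1 rfl).2
        rw [htt] at h2
        exact absurd h2.length_le hlt.not_ge
      rcases lt_or_gt_of_ne (length_mul_ofIdx_ne (b := b) j w') with h | h
      · have h1 := mul_right_le_mul_right_of_lt hle hj h
        obtain ⟨h2, h3⟩ := ih _ hlt _ _ hws ((mk_mul_of_mem hjs w').trans hw') h1 rfl
        constructor
        · have := mul_right_le_of_lt (h2.trans hsle) hj (v := t * w) (by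
            rw [mul_assoc]
            refine lt_of_le_of_ne hsle.length_le ?_
            rw [← mul_assoc]
            exact length_mul_ofIdx_ne j _)
          simpa [hs] using this
        · have := mul_right_le_of_lt (h3.trans (mul_right_bruhatLE_of_lt hlt)) hj hlt
          rw [← mul_assoc] at this
          simpa [hs] using this
      · have h1 : bruhatLE b w' (w * s) := le_mul_right_of_lt hle hj h
        obtain ⟨h2, h3⟩ := ih _ hlt _ _ hws hw' h1 rfl
        exact ⟨h2.trans hsle, h3.trans (mul_right_bruhatLE_of_lt hlt)⟩

end Cover

/-! ### Lifts of cosets -/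

section Lifts

variable [Finite ι] [P.IsCrystallographic] [P.IsReduced] {b : P.Base} {ν μ : M}

omit [Finite ι] [P.IsCrystallographic] [P.IsReduced] in
theorem proj_surjective (h : stab P ν ≤ stab P μ) (θ : Cosets P μ) :
    ∃ a : Cosets P ν, proj μ a = θ := by
  obtain ⟨u, rfl⟩ := QuotientGroup.mk_surjective θ
  exact ⟨(u : Cosets P ν), proj_mk h u⟩

/-- The class of the minimal representative lies below every x whose projection is ≥ θ, not only
below the lifts of θ. This is what keeps minimal lifts below τ. -/
theorem exists_isMinLift (hμ : IsDominantWeight b μ) (h : stab P ν ≤ stab P μ) (θ : Cosets P μ) :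
    ∃ a : Cosets P ν, IsMinLift b a θ ∧
      ∀ x : Cosets P ν, cosetLE b θ (proj μ x) → cosetLE b a x := by
  obtain ⟨u, rfl, hu⟩ := exists_isReducedRep (b := b) θ
  have key : ∀ x : Cosets P ν, cosetLE b (u : Cosets P μ) (proj μ x) →
      cosetLE b (u : Cosets P ν) x := by
    intro x hx
    obtain ⟨v, rfl⟩ := QuotientGroup.mk_surjective x
    rw [proj_mk h] at hx
    exact ((hu.cosetLE_iff hμ).mp hx).cosetLE
  exact ⟨u, ⟨proj_mk h u, fun x hx => key x (hx ▸ cosetLE_refl _)⟩, key⟩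

theorem exists_isMaxLift [P.IsRootSystem] (hμ : IsDominantWeight b μ) (h : stab P ν ≤ stab P μ)
    (θ : Cosets P μ) : ∃ a : Cosets P ν, IsMaxLift b a θ := by
  obtain ⟨u, rfl, hu⟩ := exists_maxRep hμ θ
  refine ⟨u, proj_mk h u, fun x hx => ?_⟩
  obtain ⟨v, rfl⟩ := QuotientGroup.mk_surjective x
  rw [proj_mk h] at hx
  exact (hu v hx).cosetLE

theorem exists_lift_involution_of_covBy (hμ : IsDominantWeight b μ) (h : stab P ν ≤ stab P μ)
    {θ' θ : Cosets P μ} (hcov : cosetCovBy b θ' θ) : ∃ T : Cosets P ν → Cosets P ν,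
      (∀ x, T (T x) = x) ∧ (∀ x, proj μ x = θ → proj μ (T x) = θ' ∧ cosetLE b (T x) x) ∧
      ∀ x x', proj μ x = θ → proj μ x' = θ' → cosetLE b x' x →
        cosetLE b x' (T x) ∧ cosetLE b (T x') x := by
  obtain ⟨t, htt, h1, h2⟩ := exists_involution_of_covBy hμ hcov
  have smul_mk : ∀ w : P.weylGroup, t • (w : Cosets P ν) = ((t * w : P.weylGroup) : Cosets P ν) :=
    fun w => rfl
  refine ⟨fun x => t • x, fun x => ?_, fun x hx => ?_, fun x x' hx hx' hle => ?_⟩ <;> beta_reduce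
  · rw [smul_smul, htt, one_smul]
  · obtain ⟨w, rfl⟩ := QuotientGroup.mk_surjective x
    rw [proj_mk h] at hx
    rw [smul_mk, proj_mk h]
    exact ⟨(h1 w hx).1, (h1 w hx).2.cosetLE⟩
  · obtain ⟨w', w, rfl, rfl, hle⟩ := hle
    rw [proj_mk h] at hx hx'
    rw [smul_mk, smul_mk]
    exact ⟨(h2 w w' hx hx' hle).1.cosetLE, (h2 w w' hx hx' hle).2.cosetLE⟩

end Lifts

/-! ### Index posets -/

section IndexPoset

variable {m : ℕ} {𝓘 : Set (Finset (Fin m))}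

/-- A maximal chain through K consists of m non-empty subsets of distinct cardinalities between 1
and m. So cardinality m occurs, and the full set belongs to `𝓘`. -/
theorem IsIndexPoset.univ_of_isMax (h : IsIndexPoset 𝓘) {K : 𝓘} (hK : IsMax K) :
    K.1 = Finset.univ := by
  obtain ⟨C, hC, hKC⟩ := IsChain.exists_maxChain (IsChain.singleton (r := (· ≤ ·)) (a := K))
  have hKC : K ∈ C := hKC rfl
  have hcard := h.graded _ hC
  have hinj : Set.InjOn (fun I : 𝓘 => I.1.card) C := by
    intro I hI J hJ e
    rcases hC.1.total hI hJ with h' | h'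
    · exact Subtype.ext (Finset.eq_of_subset_of_card_le h' e.ge)
    · exact (Subtype.ext (Finset.eq_of_subset_of_card_le h' e.le)).symm
  have himg : (fun I : 𝓘 => I.1.card) '' C = Set.Icc 1 m := by
    refine Set.eq_of_subset_of_ncard_le ?_ ?_ (Set.toFinite _)
    · rintro _ ⟨I, -, rfl⟩
      refine ⟨Finset.card_pos.mpr (Finset.nonempty_iff_ne_empty.mpr fun e => ?_), ?_⟩
      · exact h.empty_notMem (e ▸ I.2)
      · simpa using Finset.card_le_univ I.1
    · rw [hinj.ncard_image, hcard]
      simp [Set.ncard_eq_toFinset_card']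
  have hm : 1 ≤ m := by
    have h1 : 0 < K.1.card := Finset.card_pos.mpr (Finset.nonempty_iff_ne_empty.mpr fun e =>
      h.empty_notMem (e ▸ K.2))
    have h2 := Finset.card_le_univ K.1
    simp only [Fintype.card_fin] at h2
    omega
  obtain ⟨U, -, hU⟩ : m ∈ (fun I : 𝓘 => I.1.card) '' C := himg ▸ ⟨hm, le_rfl⟩
  have hU : U.1 = Finset.univ := (Finset.card_eq_iff_eq_univ U.1).mp (by simpa using hU)
  have : U ≤ K := hK (show K.1 ⊆ U.1 from hU ▸ Finset.subset_univ _)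
  exact Finset.eq_univ_iff_forall.mpr fun i => this (hU ▸ Finset.mem_univ i)

/-- Going down the list, i is either lost at some cover, and then the set just above has it in its
`underline`, or it survives to the last set, which is minimal and equals its own `underline`. -/
theorem exists_mem_underline {L : List 𝓘} (hL : L.IsChain fun I J => J = I ∨ J ⋖ I)
    (hmin : ∀ I ∈ L.getLast?, IsMin I) {i : Fin m} (hi : ∃ I ∈ L.head?, i ∈ I.1) :
    ∃ I ∈ L, i ∈ underline I := by
  induction L with
  | nil => simp at hi
  | cons I L ih =>
    simp only [List.head?_cons, Option.mem_some_iff, exists_eq_left'] at hi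
    cases L with
    | nil =>
      refine ⟨I, by simp, ?_⟩
      simp only [underline, Finset.mem_filter]
      exact ⟨hi, Or.inl (hmin I (by simp))⟩
    | cons J L =>
      rw [List.isChain_cons_cons] at hL
      by_cases hiJ : i ∈ J.1
      · obtain ⟨K, hK, hiK⟩ := ih hL.2 (by simpa using hmin) ⟨J, by simp, hiJ⟩
        exact ⟨K, List.mem_cons_of_mem _ hK, hiK⟩
      · refine ⟨I, by simp, ?_⟩
        simp only [underline, Finset.mem_filter]
        refine ⟨hi, Or.inr ⟨J, hL.1.resolve_left ?_, hiJ⟩⟩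
        rintro rfl
        exact hiJ hi

end IndexPoset

/-! ### The posets `W(λ, τ)` and `underline W(λ, τ)` -/

section Posets

variable {m : ℕ} {b : P.Base} {lam : Fin m → M} {𝓘 : Set (Finset (Fin m))}
  {τ : Cosets P (∑ i, lam i)}

theorem isDominantWeight_colWeight (hlam : ∀ i, IsDominantWeight b (lam i)) (I : 𝓘) :
    IsDominantWeight b (colWeight lam I) :=
  .sum fun i _ => hlam i

theorem isDominantWeight_total (hlam : ∀ i, IsDominantWeight b (lam i)) :
    IsDominantWeight b (∑ i, lam i) :=
  .sum fun i _ => hlam i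

/-- The element `(a, I)` of `W(λ, τ)`. -/
def WUp.mk (a : Cosets P (∑ i, lam i)) (I : 𝓘) (h : cosetLE b a τ) : WUp b lam 𝓘 τ :=
  ⟨(a, I), h⟩

/-- The element `(θ, I)` of `underline W(λ, τ)`. -/
def WLow.mk (I : 𝓘) (θ : Cosets P (colWeight lam I))
    (h : cosetLE b θ (proj (colWeight lam I) τ)) : WLow b lam 𝓘 τ :=
  ⟨⟨I, θ⟩, h⟩

variable [Finite ι] [P.IsCrystallographic] [P.IsReduced]

theorem stab_total_le (hlam : ∀ i, IsDominantWeight b (lam i)) (I : 𝓘) :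
    stab P (∑ i, lam i) ≤ stab P (colWeight lam I) := by
  intro w hw
  rw [MulAction.mem_stabilizer_iff, colWeight, Finset.smul_sum]
  exact Finset.sum_congr rfl fun i _ =>
    stab_sum_le (fun i _ => hlam i) (Finset.mem_univ i) hw

/-- The map `(θ, I) ↦ (π(θ), I)` from `W(λ, τ)` to `underline W(λ, τ)`. -/
def WUp.toLow (hlam : ∀ i, IsDominantWeight b (lam i)) (x : WUp b lam 𝓘 τ) : WLow b lam 𝓘 τ :=
  ⟨x.down, proj_cosetLE (stab_total_le hlam x.1.2) x.2⟩

theorem isDefiningChain_iff (hlam : ∀ i, IsDominantWeight b (lam i)) {d : List (WUp b lam 𝓘 τ)}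
    {c : List (WLow b lam 𝓘 τ)} :
    IsDefiningChain d c ↔ d.IsChain WUp.GT ∧ d.map (WUp.toLow hlam) = c := by
  refine and_congr_right fun _ => ?_
  rw [← List.forall₂_eq_eq_eq, List.forall₂_map_left_iff]
  exact ⟨fun h => h.imp fun _ _ h => Subtype.ext h,
    fun h => h.imp fun _ _ h => congrArg Subtype.val h⟩

theorem toLow_mk_eq_iff (hlam : ∀ i, IsDominantWeight b (lam i)) {a a' : Cosets P (∑ i, lam i)}
    {I : 𝓘} {h : cosetLE b a τ} {h' : cosetLE b a' τ} :
    (WUp.mk a I h).toLow hlam = (WUp.mk a' I h').toLow hlam ↔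
      proj (colWeight lam I) a = proj (colWeight lam I) a' := by
  constructor
  · intro e
    exact eq_of_heq (Sigma.mk.inj (congrArg Subtype.val e)).2
  · intro e
    exact Subtype.ext (Sigma.ext rfl (heq_of_eq e))

theorem level_eq_of_toLow_eq (hlam : ∀ i, IsDominantWeight b (lam i)) {x y : WUp b lam 𝓘 τ}
    (h : x.toLow hlam = y.toLow hlam) : x.1.2 = y.1.2 :=
  congrArg (fun z => z.1.1) h

omit [Finite ι] [P.IsCrystallographic] [P.IsReduced] in
theorem WUp.GE.refl (x : WUp b lam 𝓘 τ) : x.GE x :=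
  ⟨le_rfl, cosetLE_refl _⟩

theorem WUp.GE.trans (hlam : ∀ i, IsDominantWeight b (lam i)) {x y z : WUp b lam 𝓘 τ}
    (h : x.GE y) (h' : y.GE z) : x.GE z :=
  ⟨h'.1.trans h.1, cosetLE_trans (isDominantWeight_total hlam) h'.2 h.2⟩

theorem WUp.GE.antisymm (hlam : ∀ i, IsDominantWeight b (lam i)) {x y : WUp b lam 𝓘 τ}
    (h : x.GE y) (h' : y.GE x) : x = y :=
  Subtype.ext (Prod.ext (cosetLE_antisymm (isDominantWeight_total hlam) h'.2 h.2)
    (le_antisymm h'.1 h.1))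

theorem WLow.exists_minLift (hlam : ∀ i, IsDominantWeight b (lam i)) (z : WLow b lam 𝓘 τ) :
    ∃ x : WUp b lam 𝓘 τ, x.toLow hlam = z ∧
      ∀ a, cosetLE b z.1.2 (proj (colWeight lam z.1.1) a) → cosetLE b x.1.1 a := by
  obtain ⟨a, ha, hmin⟩ := exists_isMinLift (isDominantWeight_colWeight hlam z.1.1)
    (stab_total_le hlam z.1.1) z.1.2
  exact ⟨⟨(a, z.1.1), hmin τ z.2⟩, Subtype.ext (Sigma.ext rfl (heq_of_eq ha.1)), hmin⟩

section RootSystem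

variable [P.IsRootSystem]

/-- The extremal lifts are the most favourable witnesses, so any comparable pair suffices. None of
these lifts is required to lie below τ. -/
theorem WLow.rel_iff (hlam : ∀ i, IsDominantWeight b (lam i)) {x y : WLow b lam 𝓘 τ} :
    x.Rel y ↔ y.1.1 ≤ x.1.1 ∧ ∃ a c : Cosets P (∑ i, lam i), proj _ a = x.1.2 ∧
      proj _ c = y.1.2 ∧ cosetLE b c a := by
  refine and_congr_right fun _ => ⟨?_, ?_⟩
  · rintro ⟨a, c, ha, hc, h⟩
    exact ⟨a, c, ha.1, hc.1, h⟩
  · rintro ⟨a, c, ha, hc, h⟩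
    obtain ⟨a', ha'⟩ := exists_isMaxLift (isDominantWeight_colWeight hlam x.1.1)
      (stab_total_le hlam x.1.1) x.1.2
    obtain ⟨c', hc', -⟩ := exists_isMinLift (isDominantWeight_colWeight hlam y.1.1)
      (stab_total_le hlam y.1.1) y.1.2
    have hΛ := isDominantWeight_total hlam
    exact ⟨a', c', ha', hc', cosetLE_trans hΛ (hc'.2 c hc) (cosetLE_trans hΛ h (ha'.2 a ha))⟩

theorem WUp.GE.rel (hlam : ∀ i, IsDominantWeight b (lam i)) {x y : WUp b lam 𝓘 τ}
    (h : x.GE y) : (x.toLow hlam).Rel (y.toLow hlam) :=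
  (WLow.rel_iff hlam).mpr ⟨h.1, x.1.1, y.1.1, rfl, rfl, h.2⟩

theorem WLow.rel_mk_iff (hlam : ∀ i, IsDominantWeight b (lam i)) {I : 𝓘}
    {θ φ : Cosets P (colWeight lam I)} {h h'} :
    WLow.Rel (WLow.mk I θ h : WLow b lam 𝓘 τ) (WLow.mk I φ h') ↔ cosetLE b φ θ := by
  rw [rel_iff hlam]
  constructor
  · rintro ⟨-, a, c, ha, hc, h⟩
    have ha : proj (colWeight lam I) a = θ := ha
    have hc : proj (colWeight lam I) c = φ := hc
    rw [← ha, ← hc]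
    exact proj_cosetLE (stab_total_le hlam I) h
  · intro hle
    refine ⟨le_rfl, ?_⟩
    obtain ⟨a, ha⟩ := proj_surjective (stab_total_le hlam I) θ
    obtain ⟨c, hc, hmin⟩ := exists_isMinLift (isDominantWeight_colWeight hlam I)
      (stab_total_le hlam I) φ
    exact ⟨a, c, ha, hc.1, hmin a (ha ▸ hle)⟩

/-- Around a cycle the level is constant, and on one level (*) is the Bruhat order of W/W_{P_I}. -/
theorem WLow.GE.antisymm (hlam : ∀ i, IsDominantWeight b (lam i)) {x y : WLow b lam 𝓘 τ}
    (h : x.GE y) (h' : y.GE x) : x = y := by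
  have level : ∀ {x y : WLow b lam 𝓘 τ}, x.GE y → y.1.1 ≤ x.1.1 := by
    intro x y h
    induction h with
    | single h => exact h.1
    | tail _ h ih => exact h.1.trans ih
  have key : ∀ {x y : WLow b lam 𝓘 τ}, x.GE y → x.1.1 = y.1.1 → x.Rel y := by
    intro x y h
    induction h with
    | single h => exact fun _ => h
    | @tail y z hxy hyz ih =>
      intro e
      have e' : x.1.1 = y.1.1 := le_antisymm (e ▸ hyz.1) (level hxy)
      have h1 := ih e'
      obtain ⟨⟨I, θ⟩, hx⟩ := x
      obtain ⟨⟨J, φ⟩, hy⟩ := y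
      obtain ⟨⟨K, ψ⟩, hz⟩ := z
      obtain rfl : I = K := e
      obtain rfl : I = J := e'
      exact (rel_mk_iff hlam).mpr (cosetLE_trans (isDominantWeight_colWeight hlam I)
        ((rel_mk_iff hlam).mp hyz) ((rel_mk_iff hlam).mp h1))
  have e := le_antisymm (level h') (level h)
  have h1 := key h e
  have h2 := key h' e.symm
  obtain ⟨⟨I, θ⟩, hx⟩ := x
  obtain ⟨⟨J, φ⟩, hy⟩ := y
  obtain rfl : I = J := e
  obtain rfl := cosetLE_antisymm (isDominantWeight_colWeight hlam I) ((rel_mk_iff hlam).mp h2)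
    ((rel_mk_iff hlam).mp h1)
  rfl

end RootSystem

end Posets

/-! ### Consequences of the existence of lifts for all chains -/

section ChainsLift

variable {m : ℕ} {b : P.Base} {lam : Fin m → M} {𝓘 : Set (Finset (Fin m))}
  {τ : Cosets P (∑ i, lam i)} [Finite ι] [P.IsCrystallographic] [P.IsReduced]

variable (𝓘 τ) in
/-- Every sequence in `underline W(λ, τ)` which decreases with respect to the relation `(*)` lifts to
a weakly decreasing sequence in `W(λ, τ)`. -/
def ChainsLift (hlam : ∀ i, IsDominantWeight b (lam i)) : Prop :=
  ∀ Z : List (WLow b lam 𝓘 τ), Z.IsChain WLow.Rel →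
    ∃ d : List (WUp b lam 𝓘 τ), d.IsChain WUp.GE ∧ d.map (WUp.toLow hlam) = Z

variable {hlam : ∀ i, IsDominantWeight b (lam i)}

theorem isChain_GT_of_map {d : List (WUp b lam 𝓘 τ)} (hd : d.IsChain WUp.GE)
    (hc : (d.map (WUp.toLow hlam)).IsChain WLow.GT) : d.IsChain WUp.GT := by
  rw [List.isChain_map] at hc
  rw [List.isChain_iff_forall_rel_of_append_cons_cons] at hd hc ⊢
  intro x y l₁ l₂ e
  exact ⟨hd e, fun h => (hc e).2 (by rw [h])⟩

variable [P.IsRootSystem]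

theorem WLow.GT.trans {x y z : WLow b lam 𝓘 τ}
    (hlam : ∀ i, IsDominantWeight b (lam i)) (hxy : x.GT y) (hyz : y.GT z) : x.GT z := by
  refine ⟨Relation.TransGen.trans hxy.1 hyz.1, ?_⟩
  rintro rfl
  exact hxy.2 (hxy.1.antisymm hlam hyz.1)

variable (H : ChainsLift 𝓘 τ hlam)

include H

theorem ChainsLift.rel_trans {x y z : WLow b lam 𝓘 τ} (hxy : x.Rel y) (hyz : y.Rel z) :
    x.Rel z := by
  obtain ⟨d, hd, e⟩ := H [x, y, z] (by simp [hxy, hyz])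
  simp only [List.map_eq_cons_iff, List.map_eq_nil_iff] at e
  obtain ⟨x', _, rfl, rfl, y', _, rfl, rfl, z', _, rfl, rfl, rfl⟩ := e
  simp only [List.isChain_cons_cons, List.isChain_singleton, and_true] at hd
  exact (hd.1.trans hlam hd.2).rel hlam

theorem ChainsLift.ge_iff {x y : WLow b lam 𝓘 τ} : x.GE y ↔ x.Rel y := by
  refine ⟨fun h => ?_, fun h => .single h⟩
  induction h with
  | single h => exact h
  | tail _ h ih => exact H.rel_trans ih h

theorem ChainsLift.isStandardChain {c : List (WLow b lam 𝓘 τ)} (hc : c.IsChain WLow.GT) :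
    IsStandardChain c := by
  obtain ⟨d, hd, rfl⟩ := H c (hc.imp fun _ _ h => H.ge_iff.mp h.1)
  exact ⟨hc, d, (isDefiningChain_iff hlam).mpr ⟨isChain_GT_of_map hd hc, rfl⟩⟩

theorem ChainsLift.exists_isMaxStandardChain {c : List (WLow b lam 𝓘 τ)}
    (hc : c.IsChain WLow.GT) : ∃ c', IsMaxStandardChain c' ∧ c.Sublist c' := by
  have : Finite (WLow b lam 𝓘 τ) := inferInstanceAs (Finite (Subtype _))
  have := Fintype.ofFinite (WLow b lam 𝓘 τ)
  have : IsTrans (WLow b lam 𝓘 τ) WLow.GT := ⟨fun _ _ _ => WLow.GT.trans hlam⟩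
  set S : Set ℕ := {n | ∃ c', IsStandardChain c' ∧ c.Sublist c' ∧ c'.length = n}
  have hS : BddAbove S := by
    refine ⟨Fintype.card (WLow b lam 𝓘 τ), ?_⟩
    rintro _ ⟨c', hc', -, rfl⟩
    refine List.Nodup.length_le_card ?_
    exact (List.isChain_iff_pairwise.mp hc'.1).imp fun h => h.2
  obtain ⟨c', h1, h2, h3⟩ := Nat.sSup_mem (s := S) ⟨_, c, H.isStandardChain hc, .refl c, rfl⟩ hS
  refine ⟨c', ⟨h1, fun c'' h h' => ?_⟩, h2⟩
  exact (h'.eq_of_length_le (h3 ▸ le_csSup hS ⟨c'', h, h2.trans h', rfl⟩)).symm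

/-- Under `ChainsLift` all chains are standard, so maximal standard chains are saturated: a further
element in between could be inserted. -/
theorem IsMaxStandardChain.eq_or_eq {c₁ c₂ : List (WLow b lam 𝓘 τ)} {x y z : WLow b lam 𝓘 τ}
    (h : IsMaxStandardChain (c₁ ++ x :: y :: c₂)) (hxz : x.Rel z) (hzy : z.Rel y) :
    z = x ∨ z = y := by
  by_contra hne
  rw [not_or] at hne
  have h1 := h.1.1
  rw [List.isChain_append_cons_cons] at h1
  have h2 : (c₁ ++ x :: z :: y :: c₂).IsChain WLow.GT := by
    rw [List.isChain_append_cons_cons, List.isChain_cons_cons]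
    exact ⟨h1.1, ⟨H.ge_iff.mpr hxz, Ne.symm hne.1⟩, ⟨H.ge_iff.mpr hzy, hne.2⟩, h1.2.2⟩
  have h3 := h.2 _ (H.isStandardChain h2) (by simp)
  simpa using congrArg List.length h3

theorem IsMaxStandardChain.eq_head {c : List (WLow b lam 𝓘 τ)} {x z : WLow b lam 𝓘 τ}
    (h : IsMaxStandardChain (x :: c)) (hzx : z.Rel x) : z = x := by
  by_contra hne
  have h2 : (z :: x :: c).IsChain WLow.GT := by
    rw [List.isChain_cons_cons]
    exact ⟨⟨H.ge_iff.mpr hzx, hne⟩, h.1.1⟩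
  have h3 := h.2 _ (H.isStandardChain h2) (by simp)
  simpa using congrArg List.length h3

theorem IsMaxStandardChain.eq_last {c : List (WLow b lam 𝓘 τ)} {x z : WLow b lam 𝓘 τ}
    (h : IsMaxStandardChain (c ++ [x])) (hxz : x.Rel z) : z = x := by
  by_contra hne
  have h2 : (c ++ x :: z :: []).IsChain WLow.GT := by
    rw [List.isChain_append_cons_cons]
    exact ⟨h.1.1, ⟨H.ge_iff.mpr hxz, Ne.symm hne⟩, List.isChain_singleton z⟩
  have h3 := h.2 _ (H.isStandardChain h2) (by simp)
  simpa using congrArg List.length h3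

end ChainsLift

/-! ### Defining chains of maximal standard chains are rigid -/

section Rigid

variable {m : ℕ} {b : P.Base} {lam : Fin m → M} {𝓘 : Set (Finset (Fin m))}
  {τ : Cosets P (∑ i, lam i)} [Finite ι] [P.IsCrystallographic] [P.IsReduced]

/-- `d` is a weakly decreasing lift of a maximal standard chain. -/
def IsMaxLiftChain (hlam : ∀ i, IsDominantWeight b (lam i)) (d : List (WUp b lam 𝓘 τ)) : Prop :=
  d.IsChain WUp.GE ∧ IsMaxStandardChain (d.map (WUp.toLow hlam))

/-- Among all lifts of the projection of `p`, the element `p` has the smallest image in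
`W / W_{P_K}`. -/
def MinimalAt (K : 𝓘) (p : WUp b lam 𝓘 τ) : Prop :=
  ∀ y : Cosets P (∑ i, lam i),
    proj (colWeight lam p.1.2) y = proj (colWeight lam p.1.2) p.1.1 →
      cosetLE b (proj (colWeight lam K) p.1.1) (proj (colWeight lam K) y)

variable {hlam : ∀ i, IsDominantWeight b (lam i)} {d₁ d₂ : List (WUp b lam 𝓘 τ)}
  {p q : WUp b lam 𝓘 τ}

theorem IsMaxLiftChain.ge (h : IsMaxLiftChain hlam (d₁ ++ p :: q :: d₂)) : p.GE q :=
  (List.isChain_append_cons_cons.mp h.1).2.1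

theorem IsMaxLiftChain.gt (h : IsMaxLiftChain hlam (d₁ ++ p :: q :: d₂)) :
    (p.toLow hlam).GT (q.toLow hlam) := by
  have h1 := h.2.1.1
  rw [List.map_append, List.map_cons, List.map_cons, List.isChain_append_cons_cons] at h1
  exact h1.2.1

variable [P.IsRootSystem] (H : ChainsLift 𝓘 τ hlam)

include H

theorem IsMaxLiftChain.eq_or_eq (h : IsMaxLiftChain hlam (d₁ ++ p :: q :: d₂))
    {z : WLow b lam 𝓘 τ} (hpz : (p.toLow hlam).Rel z) (hzq : z.Rel (q.toLow hlam)) :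
    z = p.toLow hlam ∨ z = q.toLow hlam := by
  have h1 := h.2
  rw [List.map_append, List.map_cons, List.map_cons] at h1
  exact h1.eq_or_eq H hpz hzq

theorem IsMaxLiftChain.eq_or_covBy (h : IsMaxLiftChain hlam (d₁ ++ p :: q :: d₂)) :
    q.1.2 = p.1.2 ∨ q.1.2 ⋖ p.1.2 := by
  refine or_iff_not_imp_left.mpr fun hne => ⟨lt_of_le_of_ne h.ge.1 hne, fun K h1 h2 => ?_⟩
  rcases h.eq_or_eq H (z := (WUp.mk p.1.1 K p.2).toLow hlam)
    (WUp.GE.rel hlam ⟨h2.le, cosetLE_refl _⟩) (WUp.GE.rel hlam ⟨h1.le, h.ge.2⟩) with e | e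
  · exact h2.ne (level_eq_of_toLow_eq hlam e)
  · exact h1.ne (level_eq_of_toLow_eq hlam e).symm

theorem IsMaxLiftChain.coset_covBy {a a' : Cosets P (∑ i, lam i)} {I : 𝓘} {ha : cosetLE b a τ}
    {ha' : cosetLE b a' τ}
    (h : IsMaxLiftChain hlam (d₁ ++ WUp.mk a I ha :: WUp.mk a' I ha' :: d₂)) :
    cosetCovBy b (proj (colWeight lam I) a') (proj (colWeight lam I) a) := by
  refine ⟨⟨proj_cosetLE (stab_total_le hlam I) h.ge.2, fun e => ?_⟩, fun ψ h1 h2 => ?_⟩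
  · exact h.gt.2 ((toLow_mk_eq_iff hlam).mpr e.symm)
  · have hψ : cosetLE b ψ (proj (colWeight lam I) τ) :=
      cosetLE_trans (isDominantWeight_colWeight hlam I) h2.1
        (proj_cosetLE (stab_total_le hlam I) ha)
    rcases h.eq_or_eq H (z := WLow.mk I ψ hψ) ((WLow.rel_mk_iff hlam).mpr h2.1)
      ((WLow.rel_mk_iff hlam).mpr h1.1) with e | e
    · exact h2.2 (eq_of_heq (Sigma.mk.inj (congrArg Subtype.val e)).2)
    · exact h1.2 (eq_of_heq (Sigma.mk.inj (congrArg Subtype.val e)).2).symm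

/-- The coset of p placed at the level of q lies between p and q, so saturation identifies its image
with that of q. -/
theorem IsMaxLiftChain.proj_eq_of_lt (h : IsMaxLiftChain hlam (d₁ ++ p :: q :: d₂))
    (hlt : q.1.2 < p.1.2) :
    proj (colWeight lam q.1.2) p.1.1 = proj (colWeight lam q.1.2) q.1.1 := by
  rcases h.eq_or_eq H (z := (WUp.mk p.1.1 q.1.2 p.2).toLow hlam)
    (WUp.GE.rel hlam ⟨hlt.le, cosetLE_refl _⟩) (WUp.GE.rel hlam ⟨le_rfl, h.ge.2⟩) with e | e
  · exact absurd (level_eq_of_toLow_eq hlam e) hlt.ne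
  · exact (toLow_mk_eq_iff hlam).mp e

/-- Here x, a lift of the image of q below q, is placed at the level of p. It lies between p and q,
and its level rules out q. -/
theorem IsMaxLiftChain.proj_minLift_eq (h : IsMaxLiftChain hlam (d₁ ++ p :: q :: d₂))
    (hlt : q.1.2 < p.1.2) {x : WUp b lam 𝓘 τ} (hx : x.toLow hlam = q.toLow hlam)
    (hxq : cosetLE b x.1.1 q.1.1) :
    proj (colWeight lam p.1.2) x.1.1 = proj (colWeight lam p.1.2) p.1.1 := by
  have hxl := level_eq_of_toLow_eq hlam hx
  rcases h.eq_or_eq H (z := (WUp.mk x.1.1 p.1.2 x.2).toLow hlam)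
    (WUp.GE.rel hlam ⟨le_rfl, cosetLE_trans (isDominantWeight_total hlam) hxq h.ge.2⟩)
    (hx ▸ WUp.GE.rel hlam ⟨hxl.trans_le hlt.le, cosetLE_refl _⟩) with e | e
  · exact (toLow_mk_eq_iff hlam).mp e
  · exact absurd (level_eq_of_toLow_eq hlam e) hlt.ne'

/-- At a cover inside one level, the minimal representative u of the upper coset has the same image
in W/W_{P_K} as p. A suitable representative of q lies below u and is then itself minimal by
`isReducedRep_of_covBy`. At a drop of level, the minimal lift of the image of q is also a lift of
the image of p. -/
theorem IsMaxLiftChain.minimalAt_step (h : IsMaxLiftChain hlam (d₁ ++ p :: q :: d₂)) {K : 𝓘}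
    (hp : MinimalAt K p) : MinimalAt K q := by
  have hK := isDominantWeight_colWeight hlam K
  have hΛK := stab_total_le hlam K
  rcases h.eq_or_covBy H with e | hlt
  · obtain ⟨⟨a, I⟩, ha⟩ := p
    obtain ⟨⟨a', J⟩, ha'⟩ := q
    obtain rfl : J = I := e
    have hJ := isDominantWeight_colWeight hlam J
    have hΛJ := stab_total_le hlam J
    have hcov : cosetCovBy b (proj (colWeight lam J) a') (proj (colWeight lam J) a) :=
      IsMaxLiftChain.coset_covBy H (ha := ha) (ha' := ha') h
    have hle : cosetLE b a' a := h.ge.2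
    replace hp : ∀ y, proj (colWeight lam J) y = proj (colWeight lam J) a →
      cosetLE b (proj (colWeight lam K) a) (proj (colWeight lam K) y) := hp
    change ∀ y, proj (colWeight lam J) y = proj (colWeight lam J) a' →
      cosetLE b (proj (colWeight lam K) a') (proj (colWeight lam K) y)
    clear h ha ha'
    obtain ⟨w, rfl⟩ := QuotientGroup.mk_surjective a
    obtain ⟨w', rfl⟩ := QuotientGroup.mk_surjective a'
    rw [proj_mk hΛJ, proj_mk hΛJ] at hcov
    simp only [proj_mk hΛJ, proj_mk hΛK] at hp
    obtain ⟨u, hu, hur⟩ := exists_isReducedRep (b := b) (w : Cosets P (colWeight lam J))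
    have huw : (u : Cosets P (colWeight lam K)) = w := by
      refine cosetLE_antisymm hK ((hur.isMinRep hJ).2 w hu.symm).cosetLE ?_
      have := hp u (by rw [proj_mk hΛJ, hu])
      rwa [proj_mk hΛK] at this
    -- The stabilizer of κ is the intersection of those of its two summands, so W/W_κ controls both
    -- projections at once.
    set κ := colWeight lam K + colWeight lam J
    have hκ : IsDominantWeight b κ := hK.add hJ
    have hκK : stab P κ ≤ stab P (colWeight lam K) := stab_add_le_left hK hJ
    have hκJ : stab P κ ≤ stab P (colWeight lam J) := stab_add_le_right hK hJ
    have hΛκ : stab P (∑ i, lam i) ≤ stab P κ := fun g hg => by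
      rw [MulAction.mem_stabilizer_iff, smul_add, MulAction.mem_stabilizer_iff.mp (hΛK hg),
        MulAction.mem_stabilizer_iff.mp (hΛJ hg)]
    have huwκ : (w : Cosets P κ) = u := by
      rw [mk_eq_mk_iff, smul_add, smul_add, mk_eq_mk_iff.mp huw, mk_eq_mk_iff.mp hu]
    obtain ⟨v, hv, hvr⟩ := exists_isReducedRep (b := b) (w' : Cosets P κ)
    have hvu : bruhatLE b v u := by
      rw [← hvr.cosetLE_iff hκ, hv, ← huwκ, ← proj_mk hΛκ, ← proj_mk hΛκ]
      exact proj_cosetLE hΛκ hle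
    have hvJ : (v : Cosets P (colWeight lam J)) = w' := by
      rw [← proj_mk hκJ, hv, proj_mk hκJ]
    have hvK : (v : Cosets P (colWeight lam K)) = w' := by
      rw [← proj_mk hκK, hv, proj_mk hκK]
    have hvr' : IsReducedRep b (colWeight lam J) v :=
      isReducedRep_of_covBy hJ hur (by rwa [hvJ, hu]) hvu
    intro y hy
    obtain ⟨g, rfl⟩ := QuotientGroup.mk_surjective y
    rw [proj_mk hΛJ, proj_mk hΛJ] at hy
    rw [proj_mk hΛK, proj_mk hΛK, ← hvK]
    exact ((hvr'.isMinRep hJ).2 g (hy.trans hvJ.symm)).cosetLE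
  · intro y hy
    obtain ⟨x, hx, hmin⟩ := (q.toLow hlam).exists_minLift hlam
    have hxq : cosetLE b x.1.1 q.1.1 := hmin _ (cosetLE_refl _)
    have hxy : cosetLE b x.1.1 y := hmin _ (hy.symm ▸ cosetLE_refl _)
    have h1 := hp x.1.1 (h.proj_minLift_eq H hlt.lt hx hxq)
    exact cosetLE_trans hK (proj_cosetLE hΛK h.ge.2)
      (cosetLE_trans hK h1 (proj_cosetLE hΛK hxy))

/-- Each entry is minimal at its own level, hence the last entry is minimal at all levels of the
chain. The trivial coset lifts the same bottom element, so the last entry is trivial at all these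
levels. They descend by covers from the full set to a minimal one, so every λ_i is a summand of some
λ_K and is fixed. -/
theorem IsMaxLiftChain.last_eq_one (h𝓘 : IsIndexPoset 𝓘) (h : IsMaxLiftChain hlam (d₁ ++ [p])) :
    p.1.1 = ((1 : P.weylGroup) : Cosets P (∑ i, lam i)) := by
  have hlast : ∀ z, (p.toLow hlam).Rel z → z = p.toLow hlam := by
    intro z hz
    have h1 := h.2
    rw [List.map_append, List.map_cons, List.map_nil] at h1
    exact h1.eq_last H hz
  have hbot : proj (colWeight lam p.1.2) p.1.1 =
      proj (colWeight lam p.1.2) ((1 : P.weylGroup) : Cosets P (∑ i, lam i)) :=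
    ((toLow_mk_eq_iff hlam (h := one_cosetLE τ)).mp
      (hlast ((WUp.mk _ p.1.2 (one_cosetLE τ)).toLow hlam)
        (WUp.GE.rel hlam ⟨le_rfl, one_cosetLE _⟩))).symm
  have hmin : IsMin p.1.2 := fun K hK => by
    have := hlast ((WUp.mk p.1.1 K p.2).toLow hlam) (WUp.GE.rel hlam ⟨hK, cosetLE_refl _⟩)
    exact (level_eq_of_toLow_eq hlam this).ge
  have hchain : (d₁ ++ [p]).IsChain fun x y => ∀ K, MinimalAt K x → MinimalAt K y := by
    rw [List.isChain_iff_forall_rel_of_append_cons_cons]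
    intro x y l₁ l₂ e K hx
    exact IsMaxLiftChain.minimalAt_step H (e ▸ h) hx
  have hall : ∀ x ∈ d₁ ++ [p], MinimalAt x.1.2 p := by
    intro x hx
    have htrans : IsTrans (WUp b lam 𝓘 τ) fun x y => ∀ K, MinimalAt K x → MinimalAt K y :=
      ⟨fun _ _ _ h1 h2 K hK => h2 K (h1 K hK)⟩
    have hself : MinimalAt x.1.2 x := fun y hy => hy ▸ cosetLE_refl _
    rcases List.mem_append.mp hx with hx | hx
    · exact (List.pairwise_append.mp (List.isChain_iff_pairwise.mp hchain)).2.2 x hx p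
        (by simp) _ hself
    · obtain rfl := List.mem_singleton.mp hx
      exact hself
  obtain ⟨w, hw⟩ := QuotientGroup.mk_surjective p.1.1
  have hfix : ∀ x ∈ d₁ ++ [p], w ∈ stab P (colWeight lam x.1.2) := by
    intro x hx
    have h1 := hall x hx _ hbot.symm
    rw [← hw, proj_mk (stab_total_le hlam _), proj_mk (stab_total_le hlam _)] at h1
    have h2 := cosetLE_antisymm (isDominantWeight_colWeight hlam _) h1 (one_cosetLE _)
    rwa [mk_eq_mk_iff, one_smul] at h2
  have hhead : ∀ x ∈ (d₁ ++ [p]).head?, x.1.2.1 = Finset.univ := by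
    intro x hx
    refine h𝓘.univ_of_isMax fun K hK => ?_
    obtain ⟨l, e⟩ : ∃ l, d₁ ++ [p] = x :: l := ⟨_, List.eq_cons_of_mem_head? hx⟩
    have h1 := h.2
    rw [e, List.map_cons] at h1
    have := h1.eq_head H (z := (WUp.mk x.1.1 K x.2).toLow hlam)
      (WUp.GE.rel hlam ⟨hK, cosetLE_refl _⟩)
    exact (level_eq_of_toLow_eq hlam this).le
  have hlevels : ((d₁ ++ [p]).map fun x => x.1.2).IsChain fun I J => J = I ∨ J ⋖ I := by
    rw [List.isChain_map, List.isChain_iff_forall_rel_of_append_cons_cons]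
    intro x y l₁ l₂ e
    exact IsMaxLiftChain.eq_or_covBy H (e ▸ h)
  rw [← hw, mk_eq_mk_iff, one_smul, Finset.smul_sum]
  refine Finset.sum_congr rfl fun i _ => ?_
  obtain ⟨x, hx⟩ : ∃ x, x ∈ (d₁ ++ [p]).head? := by cases d₁ <;> simp
  obtain ⟨I, hI, hi⟩ := exists_mem_underline hlevels (by simpa using hmin) (i := i)
    ⟨x.1.2, by rw [List.head?_map, hx]; rfl, by rw [hhead x hx]; exact Finset.mem_univ i⟩
  obtain ⟨y, hy, rfl⟩ := List.mem_map.mp hI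
  exact stab_sum_le (fun i _ => hlam i) hi (hfix y hy)

end Rigid

/-! ### Uniqueness of lifts and the isomorphism `ρ` -/

section Isomorphism

variable {m : ℕ} {b : P.Base} {lam : Fin m → M} {𝓘 : Set (Finset (Fin m))}
  {τ : Cosets P (∑ i, lam i)} [Finite ι] [P.IsCrystallographic] [P.IsReduced]
  {hlam : ∀ i, IsDominantWeight b (lam i)} {d₁ d₂ : List (WUp b lam 𝓘 τ)}
  {p q : WUp b lam 𝓘 τ}

theorem IsMaxLiftChain.replace (h : IsMaxLiftChain hlam (d₁ ++ q :: d₂)) {q' : WUp b lam 𝓘 τ}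
    (hq : q'.GE q) (hlow : q'.toLow hlam = q.toLow hlam) (hd : (d₁ ++ [q']).IsChain WUp.GE) :
    IsMaxLiftChain hlam (d₁ ++ q' :: d₂) := by
  refine ⟨List.isChain_split.mpr ⟨hd, ?_⟩, ?_⟩
  · have h1 := (List.isChain_split.mp h.1).2
    cases d₂ with
    | nil => exact List.isChain_singleton _
    | cons r d₂ =>
      rw [List.isChain_cons_cons] at h1 ⊢
      exact ⟨hq.trans hlam h1.1, h1.2⟩
  · have h1 := h.2
    rw [List.map_append, List.map_cons] at h1 ⊢
    rwa [hlow]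

theorem toLow_eq_of_proj_eq {x y : WUp b lam 𝓘 τ} (hl : x.1.2 = y.1.2)
    (h : proj (colWeight lam y.1.2) x.1.1 = proj (colWeight lam y.1.2) y.1.1) :
    x.toLow hlam = y.toLow hlam := by
  obtain ⟨⟨a, I⟩, ha⟩ := x
  obtain ⟨⟨a', J⟩, ha'⟩ := y
  obtain rfl : I = J := hl
  exact (toLow_mk_eq_iff hlam).mpr h

theorem proj_eq_of_toLow_eq {x y : WUp b lam 𝓘 τ} (h : x.toLow hlam = y.toLow hlam) :
    proj (colWeight lam y.1.2) x.1.1 = proj (colWeight lam y.1.2) y.1.1 := by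
  have hl := level_eq_of_toLow_eq hlam h
  obtain ⟨⟨a, I⟩, ha⟩ := x
  obtain ⟨⟨a', J⟩, ha'⟩ := y
  obtain rfl : I = J := hl
  exact (toLow_mk_eq_iff hlam).mp h

variable [P.IsRootSystem] (H : ChainsLift 𝓘 τ hlam)

include H

theorem IsMaxLiftChain.exists_involution (h : IsMaxLiftChain hlam (d₁ ++ p :: q :: d₂))
    (hl : q.1.2 = p.1.2) :
    ∃ T : Cosets P (∑ i, lam i) → Cosets P (∑ i, lam i), (∀ x, T (T x) = x) ∧
      (∀ x, proj (colWeight lam p.1.2) x = proj (colWeight lam p.1.2) p.1.1 →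
        proj (colWeight lam q.1.2) (T x) = proj (colWeight lam q.1.2) q.1.1 ∧
          cosetLE b (T x) x) ∧
      ∀ x x', proj (colWeight lam p.1.2) x = proj (colWeight lam p.1.2) p.1.1 →
        proj (colWeight lam q.1.2) x' = proj (colWeight lam q.1.2) q.1.1 →
        cosetLE b x' x → cosetLE b x' (T x) ∧ cosetLE b (T x') x := by
  obtain ⟨⟨a, I⟩, ha⟩ := p
  obtain ⟨⟨a', J⟩, ha'⟩ := q
  obtain rfl : J = I := hl
  exact exists_lift_involution_of_covBy (isDominantWeight_colWeight hlam J)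
    (stab_total_le hlam J) (IsMaxLiftChain.coset_covBy H (ha := ha) (ha' := ha') h)

/-- An entry of a defining chain of a maximal standard chain cannot be replaced by a larger one. -/
theorem IsMaxLiftChain.eq_of_ge (h𝓘 : IsIndexPoset 𝓘) (h : IsMaxLiftChain hlam (d₁ ++ q :: d₂))
    {q' : WUp b lam 𝓘 τ} (hq : q'.GE q) (hlow : q'.toLow hlam = q.toLow hlam)
    (hd : (d₁ ++ [q']).IsChain WUp.GE) : q' = q := by
  have hΛ := isDominantWeight_total hlam
  induction d₂ generalizing d₁ q q' with
  | nil =>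
    have h' := h.replace hq hlow hd
    exact Subtype.ext (Prod.ext ((h'.last_eq_one H h𝓘).trans (h.last_eq_one H h𝓘).symm)
      (level_eq_of_toLow_eq hlam hlow))
  | cons r d₂ ih =>
    have h' := h.replace hq hlow hd
    have hqlev := level_eq_of_toLow_eq hlam hlow
    suffices cosetLE b q'.1.1 q.1.1 from WUp.GE.antisymm hlam hq ⟨hqlev.le, this⟩
    have h'' : IsMaxLiftChain hlam ((d₁ ++ [q']) ++ r :: d₂) := by simpa using h'
    rcases h.eq_or_covBy H with hl | hlt
    -- Inside one level, `T q'` is a lift of the image of r above r, so induction gives `T q' = r`,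
    -- and `q' = T r ≤ q`.
    · obtain ⟨T, hTT, hT1, hT2⟩ := h.exists_involution H hl
      have hq'p := proj_eq_of_toLow_eq hlow
      obtain ⟨h1, h2⟩ := hT1 q'.1.1 hq'p
      have h3 := (hT2 q'.1.1 r.1.1 hq'p rfl h'.ge.2).1
      have e := ih h'' (q' := WUp.mk (T q'.1.1) r.1.2 (cosetLE_trans hΛ h2 q'.2)) ⟨le_rfl, h3⟩
        (toLow_eq_of_proj_eq rfl h1) (by
          rw [List.append_assoc]
          exact List.isChain_append_cons_cons.mpr
            ⟨hd, ⟨h'.ge.1, h2⟩, List.isChain_singleton _⟩)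
      have e : T q'.1.1 = r.1.1 := congrArg (fun x => x.1.1) e
      rw [← hTT q'.1.1, e]
      exact (hT2 q.1.1 r.1.1 rfl rfl h.ge.2).2
    -- At a drop of level, the coset of q' itself lifts the image of r; induction makes it equal to
    -- that of r, which lies below q.
    · have hproj := h'.proj_eq_of_lt H (hlt.lt.trans_eq hqlev.symm)
      have e := ih h'' (q' := WUp.mk q'.1.1 r.1.2 q'.2) ⟨le_rfl, h'.ge.2⟩
        (toLow_eq_of_proj_eq rfl hproj) (by
          rw [List.append_assoc]
          exact List.isChain_append_cons_cons.mpr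
            ⟨hd, ⟨h'.ge.1, cosetLE_refl _⟩, List.isChain_singleton _⟩)
      have e : q'.1.1 = r.1.1 := congrArg (fun x => x.1.1) e
      rw [e]
      exact h.ge.2

theorem IsMaxLiftChain.head_eq (h𝓘 : IsIndexPoset 𝓘) (h : IsMaxLiftChain hlam (p :: d₂)) :
    p.1.1 = τ := by
  have h1 := h.2
  rw [List.map_cons] at h1
  have hge : (WUp.mk τ p.1.2 (cosetLE_refl τ)).GE p := ⟨le_rfl, p.2⟩
  have h2 := IsMaxLiftChain.eq_of_ge (d₁ := []) H h𝓘 h hge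
    (h1.eq_head H (WUp.GE.rel hlam hge)) (List.isChain_singleton _)
  exact congrArg (fun x => x.1.1) h2.symm

/-- In a defining chain of a maximal standard chain, each entry is the largest lift below its
predecessor and the smallest lift above its successor. -/
theorem IsMaxLiftChain.extremal (h𝓘 : IsIndexPoset 𝓘)
    (h : IsMaxLiftChain hlam (d₁ ++ p :: q :: d₂)) :
    (∀ x, proj (colWeight lam q.1.2) x = proj (colWeight lam q.1.2) q.1.1 →
      cosetLE b x p.1.1 → cosetLE b x q.1.1) ∧
    ∀ x, proj (colWeight lam p.1.2) x = proj (colWeight lam p.1.2) p.1.1 →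
      cosetLE b q.1.1 x → cosetLE b p.1.1 x := by
  have hΛ := isDominantWeight_total hlam
  have hd := (List.isChain_append_cons_cons.mp h.1).1
  have h' : IsMaxLiftChain hlam ((d₁ ++ [p]) ++ q :: d₂) := by simpa using h
  rcases h.eq_or_covBy H with hl | hlt
  · obtain ⟨T, hTT, hT1, hT2⟩ := h.exists_involution H hl
    -- `T p` lifts the image of q and lies between q and p, so it is q because q cannot be enlarged.
    -- Both extremal properties follow from `T p = q`.
    obtain ⟨h1, h2⟩ := hT1 p.1.1 rfl
    have e := h'.eq_of_ge H h𝓘 (q' := WUp.mk (T p.1.1) q.1.2 (cosetLE_trans hΛ h2 p.2))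
      ⟨le_rfl, (hT2 _ _ rfl rfl h.ge.2).1⟩ (toLow_eq_of_proj_eq rfl h1) (by
        rw [List.append_assoc]
        exact List.isChain_append_cons_cons.mpr ⟨hd, ⟨h.ge.1, h2⟩, List.isChain_singleton _⟩)
    have e : T p.1.1 = q.1.1 := congrArg (fun x => x.1.1) e
    refine ⟨fun x hx hle => e ▸ (hT2 _ _ rfl hx hle).1, fun x hx hle => ?_⟩
    have := (hT2 _ _ hx rfl hle).2
    rwa [← e, hTT] at this
  · have hproj := h.proj_eq_of_lt H hlt.lt
    have e := h'.eq_of_ge H h𝓘 (q' := WUp.mk p.1.1 q.1.2 p.2) ⟨le_rfl, h.ge.2⟩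
      (toLow_eq_of_proj_eq rfl hproj) (by
        rw [List.append_assoc]
        exact List.isChain_append_cons_cons.mpr
          ⟨hd, ⟨h.ge.1, cosetLE_refl _⟩, List.isChain_singleton _⟩)
    have e : p.1.1 = q.1.1 := congrArg (fun x => x.1.1) e
    exact ⟨fun x _ hle => e ▸ hle, fun x _ hle => e ▸ hle⟩

/-- Starting from τ, which bounds everything, each entry of the chain is the largest lift below its
predecessor; so it bounds any other lift of the upper part. Dually, `ge_of_lift` climbs from the
trivial coset. -/
theorem IsMaxLiftChain.le_of_lift (h𝓘 : IsIndexPoset 𝓘) (h : IsMaxLiftChain hlam (d₁ ++ p :: d₂))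
    {e₁ : List (WUp b lam 𝓘 τ)} {r : WUp b lam 𝓘 τ} (he : (e₁ ++ [r]).IsChain WUp.GE)
    (hmap : (e₁ ++ [r]).map (WUp.toLow hlam) = (d₁ ++ [p]).map (WUp.toLow hlam)) :
    cosetLE b r.1.1 p.1.1 := by
  induction d₁ using List.reverseRecOn generalizing p d₂ e₁ r with
  | nil =>
    rw [h.head_eq H h𝓘]
    exact r.2
  | append_singleton d₁ s ih =>
    simp only [List.map_append, List.map_cons, List.map_nil] at hmap
    obtain ⟨hmap, hr⟩ := List.append_inj' hmap rfl
    obtain ⟨e₀, t, rfl⟩ : ∃ e₀ t, e₁ = e₀ ++ [t] := by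
      rcases e₁.eq_nil_or_concat with rfl | ⟨e₀, t, rfl⟩
      · simp at hmap
      · exact ⟨e₀, t, by simp⟩
    have h' : IsMaxLiftChain hlam (d₁ ++ s :: p :: d₂) := by simpa using h
    rw [List.append_assoc] at he
    obtain ⟨he1, he2, -⟩ := List.isChain_append_cons_cons.mp he
    have hts := ih h' he1 (by simpa using hmap)
    exact (h'.extremal H h𝓘).1 _ (proj_eq_of_toLow_eq (by simpa using hr))
      (cosetLE_trans (isDominantWeight_total hlam) he2.2 hts)

theorem IsMaxLiftChain.ge_of_lift (h𝓘 : IsIndexPoset 𝓘) (h : IsMaxLiftChain hlam (d₁ ++ p :: d₂))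
    {e₂ : List (WUp b lam 𝓘 τ)} {r : WUp b lam 𝓘 τ} (he : (r :: e₂).IsChain WUp.GE)
    (hmap : (r :: e₂).map (WUp.toLow hlam) = (p :: d₂).map (WUp.toLow hlam)) :
    cosetLE b p.1.1 r.1.1 := by
  induction d₂ generalizing p d₁ e₂ r with
  | nil =>
    rw [h.last_eq_one H h𝓘]
    exact one_cosetLE _
  | cons q d₂ ih =>
    cases e₂ with
    | nil => simp at hmap
    | cons s e₂ =>
      obtain ⟨hr, hmap⟩ := List.cons.inj hmap
      rw [List.isChain_cons_cons] at he
      have h' : IsMaxLiftChain hlam ((d₁ ++ [p]) ++ q :: d₂) := by simpa using h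
      exact (h.extremal H h𝓘).2 _ (proj_eq_of_toLow_eq hr)
        (cosetLE_trans (isDominantWeight_total hlam) (ih h' he.2 hmap) he.1.2)

/-- The part of the first chain above the common element, glued to the part of the second below it,
lifts by `ChainsLift`. The entry of this lift at the junction is ≤ p and ≥ p'. -/
theorem IsMaxLiftChain.le_of_toLow_eq (h𝓘 : IsIndexPoset 𝓘)
    (h : IsMaxLiftChain hlam (d₁ ++ p :: d₂)) {d₁' d₂' : List (WUp b lam 𝓘 τ)}
    {p' : WUp b lam 𝓘 τ} (h' : IsMaxLiftChain hlam (d₁' ++ p' :: d₂'))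
    (e : p.toLow hlam = p'.toLow hlam) : cosetLE b p'.1.1 p.1.1 := by
  have h1 := h.2.1.1
  have h2 := h'.2.1.1
  rw [List.map_append, List.map_cons, List.isChain_split] at h1 h2
  have h3 : (d₁.map (WUp.toLow hlam) ++ p'.toLow hlam :: d₂'.map (WUp.toLow hlam)).IsChain
      WLow.Rel :=
    (List.isChain_split.mpr ⟨e ▸ h1.1, h2.2⟩).imp fun _ _ h => H.ge_iff.mp h.1
  obtain ⟨f, hf, hmap⟩ := H _ h3
  obtain ⟨e₁, f₂, rfl, he₁, hf₂⟩ := List.map_eq_append_iff.mp hmap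
  obtain ⟨r, e₂, rfl, hr, he₂⟩ := List.map_eq_cons_iff.mp hf₂
  obtain ⟨hf1, hf2⟩ := List.isChain_split.mp hf
  have h4 := h.le_of_lift H h𝓘 hf1 (by simp [he₁, hr, e])
  have h5 := h'.ge_of_lift H h𝓘 hf2 (by simp [he₂, hr])
  exact cosetLE_trans (isDominantWeight_total hlam) h5 h4

theorem IsMaxLiftChain.eq_of_toLow_eq (h𝓘 : IsIndexPoset 𝓘) {d d' : List (WUp b lam 𝓘 τ)}
    (h : IsMaxLiftChain hlam d) (h' : IsMaxLiftChain hlam d') {x x' : WUp b lam 𝓘 τ}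
    (hx : x ∈ d) (hx' : x' ∈ d') (e : x.toLow hlam = x'.toLow hlam) : x = x' := by
  obtain ⟨d₁, d₂, rfl⟩ := List.append_of_mem hx
  obtain ⟨d₁', d₂', rfl⟩ := List.append_of_mem hx'
  exact Subtype.ext (Prod.ext (cosetLE_antisymm (isDominantWeight_total hlam)
    (h'.le_of_toLow_eq H h𝓘 h e.symm) (h.le_of_toLow_eq H h𝓘 h' e)) (level_eq_of_toLow_eq hlam e))

theorem ChainsLift.exists_isMaxLiftChain {c : List (WLow b lam 𝓘 τ)} (hc : c.IsChain WLow.GT) :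
    ∃ d, IsMaxLiftChain hlam d ∧ IsDefiningChain d (d.map (WUp.toLow hlam)) ∧
      c.Sublist (d.map (WUp.toLow hlam)) := by
  obtain ⟨c', hc', hsub⟩ := H.exists_isMaxStandardChain hc
  obtain ⟨d, hd⟩ := hc'.1.2
  obtain ⟨hd1, rfl⟩ := (isDefiningChain_iff hlam).mp hd
  exact ⟨d, ⟨hd1.imp fun _ _ h => h.1, hc'⟩, hd, hsub⟩

omit H in
omit [P.IsRootSystem] in
theorem DCP.exists_isMaxLiftChain {x : WUp b lam 𝓘 τ} (hx : x ∈ DCP b lam 𝓘 τ) :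
    ∃ d, IsMaxLiftChain hlam d ∧ x ∈ d := by
  obtain ⟨c, d, hc, hd, hx⟩ := hx
  obtain ⟨hd1, rfl⟩ := (isDefiningChain_iff hlam).mp hd
  exact ⟨d, ⟨hd1.imp fun _ _ h => h.1, hc⟩, hx⟩

/-- Uniqueness of lifts gives injectivity; extending one element, or a comparable pair, to a maximal
standard chain gives surjectivity and the comparison of orders. -/
theorem ChainsLift.isTauStandard (h𝓘 : IsIndexPoset 𝓘) : IsTauStandard b lam 𝓘 τ := by
  have hinj : Function.Injective fun x : DCP b lam 𝓘 τ => x.1.toLow hlam := by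
    intro x y e
    obtain ⟨d, hd, hx⟩ := DCP.exists_isMaxLiftChain (hlam := hlam) x.2
    obtain ⟨d', hd', hy⟩ := DCP.exists_isMaxLiftChain (hlam := hlam) y.2
    exact Subtype.ext (hd.eq_of_toLow_eq H h𝓘 hd' hx hy e)
  have hsurj : Function.Surjective fun x : DCP b lam 𝓘 τ => x.1.toLow hlam := by
    intro z
    obtain ⟨d, hd, hdef, hsub⟩ := H.exists_isMaxLiftChain (List.isChain_singleton z)
    obtain ⟨x, hx, rfl⟩ := List.mem_map.mp (List.singleton_sublist.mp hsub)
    exact ⟨⟨x, _, d, hd.2, hdef, hx⟩, rfl⟩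
  refine ⟨⟨Equiv.ofBijective _ ⟨hinj, hsurj⟩, ?_⟩, fun x => rfl⟩
  intro x y
  change WLow.GE (x.1.toLow hlam) (y.1.toLow hlam) ↔ DCP.GE x y
  refine ⟨fun h => ?_, fun h => .single (h.1.rel hlam)⟩
  by_cases hxy : x = y
  · subst hxy
    obtain ⟨c, d, hc, hd, hx⟩ := x.2
    exact ⟨.refl _, c, d, hc, hd, hx, hx⟩
  · have hne : x.1.toLow hlam ≠ y.1.toLow hlam := fun e => hxy (hinj e)
    obtain ⟨d, hd, hdef, hsub⟩ := H.exists_isMaxLiftChain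
      (c := [x.1.toLow hlam, y.1.toLow hlam]) (by simpa using ⟨h, hne⟩)
    obtain ⟨l, hl, e⟩ := List.sublist_map_iff.mp hsub
    simp only [eq_comm (a := [_, _]), List.map_eq_cons_iff, List.map_eq_nil_iff] at e
    obtain ⟨x', _, rfl, hx', y', _, rfl, hy', rfl⟩ := e
    have hmem : ∀ z : DCP b lam 𝓘 τ, ∀ z' ∈ [x', y'], z'.toLow hlam = z.1.toLow hlam →
        z' = z.1 := by
      intro z z' hz' e
      obtain ⟨d', hd', hz⟩ := DCP.exists_isMaxLiftChain (hlam := hlam) z.2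
      exact hd.eq_of_toLow_eq H h𝓘 hd' (hl.subset hz') hz e
    have ex := hmem x x' (by simp) hx'
    have ey := hmem y y' (by simp) hy'
    have htrans : IsTrans (WUp b lam 𝓘 τ) WUp.GE := ⟨fun _ _ _ h h' => h.trans hlam h'⟩
    have hpw := (List.isChain_iff_pairwise.mp hd.1).sublist hl
    simp only [List.pairwise_cons, List.mem_singleton, forall_eq] at hpw
    refine ⟨ex ▸ ey ▸ hpw.1, _, d, hd.2, hdef, ?_, ?_⟩
    · exact ex ▸ hl.subset (by simp)
    · exact ey ▸ hl.subset (by simp)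

end Isomorphism

/-! ### Tableaux of type `(λ, 𝓘)` -/

theorem forall₂_imp_of_mem {α β : Type*} {R S : α → β → Prop} {l₁ : List α} {l₂ : List β}
    (h : List.Forall₂ R l₁ l₂) (hRS : ∀ x, ∀ y ∈ l₂, R x y → S x y) : List.Forall₂ S l₁ l₂ := by
  induction h with
  | nil => exact .nil
  | cons h _ ih =>
    exact .cons (hRS _ _ List.mem_cons_self h) (ih fun x y hy => hRS x y (List.mem_cons_of_mem _ hy))

section Columns

variable {m : ℕ} {b : P.Base} {lam : Fin m → M} {𝓘 : Set (Finset (Fin m))}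
  {τ : Cosets P (∑ i, lam i)}

variable (b lam 𝓘) in
/-- An LS-path of shape `λ_I` together with the index `I`. -/
abbrev Column : Type _ := Σ I : 𝓘, LSPath b (colWeight lam I)

/-- The underlying LS-path of an indexed column. -/
def Column.toPath (c : Column b lam 𝓘) : Σ ν : M, LSPath b ν := ⟨colWeight lam c.1, c.2⟩

/-- The cosets of a column in decreasing order. -/
def Column.cosets (c : Column b lam 𝓘) : List (Σ I : 𝓘, Cosets P (colWeight lam I)) :=
  (List.ofFn fun k => (⟨c.1, c.2.σ k⟩ : Σ I : 𝓘, Cosets P (colWeight lam I))).reverse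

/-- The column which consists of a single coset. -/
def Column.single (e : Σ I : 𝓘, Cosets P (colWeight lam I)) : Column b lam 𝓘 :=
  ⟨e.1, { n := 0, σ := fun _ => e.2, d := fun _ => 1, σ_lt := fun k => k.elim0,
          d_lt := fun k => k.elim0, d_one := rfl, d_pos := one_pos, chain := fun k => k.elim0 }⟩

theorem Column.cosets_single (e : Σ I : 𝓘, Cosets P (colWeight lam I)) :
    (Column.single (b := b) e).cosets = [e] := by
  simp [Column.single, Column.cosets]

theorem Column.level_of_mem_cosets {c : Column b lam 𝓘} {e : Σ I : 𝓘, Cosets P (colWeight lam I)}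
    (h : e ∈ c.cosets) : e.1 = c.1 := by
  rw [Column.cosets, List.mem_reverse, List.mem_ofFn] at h
  obtain ⟨k, rfl⟩ := h
  rfl

theorem Column.cosets_ne_nil (c : Column b lam 𝓘) : c.cosets ≠ [] := by
  simp [Column.cosets, List.ofFn_eq_nil_iff]

/-- Distinct indices may have equal weights λ_I, so the index of each column is recorded along with
its path. -/
theorem exists_columns {T : LSTableau b} {Is : List 𝓘} (h : shape T = Is.map (colWeight lam)) :
    ∃ C : List (Column b lam 𝓘), C.map Column.toPath = T ∧ C.map Sigma.fst = Is := by
  induction T generalizing Is with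
  | nil =>
    obtain rfl : Is = [] := by simpa [shape] using h.symm
    exact ⟨[], rfl, rfl⟩
  | cons c T ih =>
    obtain ⟨I, Is', rfl, hI, hIs⟩ := List.map_eq_cons_iff.mp h.symm
    obtain ⟨C, hC, hC'⟩ := ih hIs.symm
    obtain ⟨ν, π⟩ := c
    obtain rfl : colWeight lam I = ν := hI
    exact ⟨⟨I, π⟩ :: C, by simp [hC, Column.toPath], by simp [hC']⟩

theorem entries_map_toPath (C : List (Column b lam 𝓘)) :
    entries (C.map Column.toPath) =
      (C.flatMap Column.cosets).map fun e => ⟨colWeight lam e.1, e.2⟩ := by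
  rw [entries, List.flatMap_map, List.map_flatMap]
  refine congrArg (C.flatMap ·) (funext fun c => ?_)
  simp [Column.cosets, Column.toPath, List.map_ofFn, Function.comp_def]

theorem weight_cons (c : Column b lam 𝓘) (C : List (Column b lam 𝓘)) :
    weight ((c :: C).map Column.toPath) = colWeight lam c.1 + weight (C.map Column.toPath) := by
  simp [weight, shape, Column.toPath]

theorem isDominantWeight_weight (hlam : ∀ i, IsDominantWeight b (lam i))
    (C : List (Column b lam 𝓘)) : IsDominantWeight b (weight (C.map Column.toPath)) := by
  induction C with
  | nil => exact .zero
  | cons c C ih =>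
    rw [weight_cons]
    exact (isDominantWeight_colWeight hlam c.1).add ih

theorem le_stab_weight {C : List (Column b lam 𝓘)} {G : Subgroup P.weylGroup}
    (h : ∀ c ∈ C, G ≤ stab P (colWeight lam c.1)) : G ≤ stab P (weight (C.map Column.toPath)) := by
  induction C with
  | nil => exact fun g _ => smul_zero g
  | cons c C ih =>
    intro g hg
    have h1 : g • colWeight lam c.1 = colWeight lam c.1 := h c List.mem_cons_self hg
    have h2 : g • weight (C.map Column.toPath) = weight (C.map Column.toPath) :=
      ih (fun c hc => h c (List.mem_cons_of_mem _ hc)) hg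
    rw [weight_cons, MulAction.mem_stabilizer_iff, smul_add, h1, h2]

theorem exists_WUp_list {c : List (Cosets P (∑ i, lam i))}
    {E : List (Σ I : 𝓘, Cosets P (colWeight lam I))}
    (h : List.Forall₂ (fun x e => proj (colWeight lam e.1) x = e.2) c E)
    (hc : ∀ x ∈ c, cosetLE b x τ) :
    ∃ d : List (WUp b lam 𝓘 τ), d.map (fun x => x.1.1) = c ∧ d.map WUp.down = E := by
  induction h with
  | nil => exact ⟨[], rfl, rfl⟩
  | @cons x e c E h _ ih =>
    obtain ⟨d, rfl, rfl⟩ := ih fun x hx => hc x (List.mem_cons_of_mem _ hx)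
    refine ⟨WUp.mk x e.1 (hc x List.mem_cons_self) :: d, rfl, ?_⟩
    rw [List.map_cons, List.cons.injEq]
    exact ⟨Sigma.ext rfl (heq_of_eq h), rfl⟩

variable [Finite ι] [P.IsCrystallographic] [P.IsReduced]

theorem stab_weight_le (hlam : ∀ i, IsDominantWeight b (lam i)) {C : List (Column b lam 𝓘)}
    {c : Column b lam 𝓘} (hc : c ∈ C) :
    stab P (weight (C.map Column.toPath)) ≤ stab P (colWeight lam c.1) := by
  induction C with
  | nil => simp at hc
  | cons c' C ih =>
    rw [weight_cons]
    have h1 := isDominantWeight_colWeight hlam c'.1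
    have h2 := isDominantWeight_weight hlam C
    rcases List.mem_cons.mp hc with rfl | hc
    · exact stab_add_le_left h1 h2
    · exact (stab_add_le_right h1 h2).trans (ih hc)

theorem proj_weight_proj (hlam : ∀ i, IsDominantWeight b (lam i)) {C C' : List (Column b lam 𝓘)}
    (h : C' ⊆ C) (x : Cosets P (∑ i, lam i)) :
    proj (weight (C'.map Column.toPath)) (proj (weight (C.map Column.toPath)) x) =
      proj (weight (C'.map Column.toPath)) x :=
  proj_proj (le_stab_weight fun c _ => stab_total_le hlam c.1)
    (le_stab_weight fun _ hc => stab_weight_le hlam (h hc)) x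

/-- Minimal lifts carry a defining chain from W/W_μ to W/W_Q without leaving the elements below τ,
and projection carries it back. Tableaux of different total weights can thus be treated in the same
W/W_Q. -/
theorem isStandard_iff_exists_lift (hlam : ∀ i, IsDominantWeight b (lam i))
    (C : List (Column b lam 𝓘)) :
    IsStandard (C.map Column.toPath) (proj (weight (C.map Column.toPath)) τ) ↔
      ∃ c : List (Cosets P (∑ i, lam i)), (τ :: c).IsChain (fun x y => cosetLE b y x) ∧
        List.Forall₂ (fun x e => proj (colWeight lam e.1) x = e.2) c
          (C.flatMap Column.cosets) := by
  have hΛ : stab P (∑ i, lam i) ≤ stab P (weight (C.map Column.toPath)) :=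
    le_stab_weight fun c _ => stab_total_le hlam c.1
  have hE : ∀ e ∈ C.flatMap Column.cosets,
      stab P (weight (C.map Column.toPath)) ≤ stab P (colWeight lam e.1) := by
    intro e he
    obtain ⟨c, hc, he⟩ := List.mem_flatMap.mp he
    rw [Column.level_of_mem_cosets he]
    exact stab_weight_le hlam hc
  have hdom := isDominantWeight_weight hlam C
  rw [IsStandard, entries_map_toPath]
  simp only [List.forall₂_map_right_iff]
  generalize weight (C.map Column.toPath) = μ at *
  constructor
  · rintro ⟨c, hc, hc'⟩
    choose f hf hmin using fun θ : Cosets P μ =>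
      exists_isMinLift (ν := ∑ i, lam i) hdom hΛ θ
    refine ⟨c.map f, ?_, ?_⟩
    · cases c with
      | nil => exact List.isChain_singleton τ
      | cons x c =>
        rw [List.isChain_cons_cons] at hc
        rw [List.map_cons, List.isChain_cons_cons]
        refine ⟨hmin x τ hc.1, ?_⟩
        rw [← List.map_cons, List.isChain_map]
        exact hc.2.imp fun x y hxy => hmin y (f x) ((hf x).1.symm ▸ hxy)
    · rw [List.forall₂_map_left_iff]
      refine forall₂_imp_of_mem hc' fun x e he h => ?_
      rw [← h, ← proj_proj hΛ (hE e he), (hf x).1]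
  · rintro ⟨c, hc, hc'⟩
    refine ⟨c.map (proj μ), ?_, ?_⟩
    · rw [← List.map_cons, List.isChain_map]
      exact hc.imp fun x y hxy => proj_cosetLE hΛ hxy
    · rw [List.forall₂_map_left_iff]
      refine forall₂_imp_of_mem hc' fun x e he h => ?_
      rw [proj_proj hΛ (hE e he), h]

/-- The bound τ is built into `WUp` and the levels already decrease, so a defining chain is just a
decreasing list in `WUp`. -/
theorem isStandard_iff (hlam : ∀ i, IsDominantWeight b (lam i)) {C : List (Column b lam 𝓘)}
    (hC : (C.map Sigma.fst).IsChain fun I J => J ≤ I) :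
    IsStandard (C.map Column.toPath) (proj (weight (C.map Column.toPath)) τ) ↔
      ∃ d : List (WUp b lam 𝓘 τ), d.IsChain WUp.GE ∧
        d.map WUp.down = C.flatMap Column.cosets := by
  have hΛ := isDominantWeight_total hlam
  have htrans : IsTrans (Cosets P (∑ i, lam i)) fun x y => cosetLE b y x :=
    ⟨fun _ _ _ h h' => cosetLE_trans hΛ h' h⟩
  have hlevels : (C.flatMap Column.cosets).Pairwise fun e e' => e'.1 ≤ e.1 := by
    have htrans : IsTrans 𝓘 fun I J => J ≤ I := ⟨fun _ _ _ h h' => h'.trans h⟩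
    rw [List.isChain_iff_pairwise, List.pairwise_map] at hC
    refine List.pairwise_flatMap.mpr ⟨fun c _ => ?_, hC.imp fun h e he e' he' => ?_⟩
    · refine List.pairwise_of_forall_mem_list fun e he e' he' => ?_
      rw [Column.level_of_mem_cosets he, Column.level_of_mem_cosets he']
    · rwa [Column.level_of_mem_cosets he, Column.level_of_mem_cosets he']
  rw [isStandard_iff_exists_lift hlam]
  constructor
  · rintro ⟨c, hc, hcE⟩
    have hle : ∀ x ∈ c, cosetLE b x τ := (List.pairwise_cons.mp (List.isChain_iff_pairwise.mp hc)).1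
    obtain ⟨d, rfl, hd⟩ := exists_WUp_list hcE hle
    refine ⟨d, ?_, hd⟩
    have h1 := (List.pairwise_cons.mp (List.isChain_iff_pairwise.mp hc)).2
    rw [← hd, List.pairwise_map] at hlevels
    rw [List.pairwise_map] at h1
    exact (hlevels.and h1).isChain
  · rintro ⟨d, hd, hdE⟩
    refine ⟨d.map fun x => x.1.1, ?_, ?_⟩
    · cases d with
      | nil => exact List.isChain_singleton τ
      | cons x d =>
        rw [List.map_cons, List.isChain_cons_cons]
        refine ⟨x.2, ?_⟩
        rw [← List.map_cons (f := fun x : WUp b lam 𝓘 τ => x.1.1), List.isChain_map]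
        exact hd.imp fun _ _ h => h.2
    · rw [← hdE, List.forall₂_map_left_iff, List.forall₂_map_right_iff]
      exact List.forall₂_same.mpr fun x _ => rfl

end Columns

/-! ### The main equivalence -/

section Main

variable {m : ℕ} {b : P.Base} {lam : Fin m → M} {𝓘 : Set (Finset (Fin m))}
  {τ : Cosets P (∑ i, lam i)} [Finite ι] [P.IsCrystallographic] [P.IsReduced] [P.IsRootSystem]

omit [Finite ι] [P.IsCrystallographic] [P.IsReduced] [P.IsRootSystem] in
theorem IsTauStandard.exists_lift (h : IsTauStandard b lam 𝓘 τ) :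
    ∃ f : WLow b lam 𝓘 τ → WUp b lam 𝓘 τ, (∀ z, (f z).down = z.1) ∧
      ∀ z z', z.GE z' → (f z).GE (f z') := by
  obtain ⟨ρ, hρ⟩ := h
  refine ⟨fun z => (ρ.symm z).1, fun z => ?_, fun z z' hz => ?_⟩
  · rw [← hρ, RelIso.apply_symm_apply]
  · exact ((ρ.symm.map_rel_iff (a := z) (b := z')).mpr hz).1

theorem IsTauStandard.rel_trans (hlam : ∀ i, IsDominantWeight b (lam i))
    (h : IsTauStandard b lam 𝓘 τ) {x y z : WLow b lam 𝓘 τ} (hxy : x.Rel y) (hyz : y.Rel z) :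
    x.Rel z := by
  obtain ⟨f, hf, hmono⟩ := h.exists_lift
  have hlow : ∀ z, (f z).toLow hlam = z := fun z => Subtype.ext (hf z)
  have := (hmono x z (.tail (.single hxy) hyz)).rel hlam
  rwa [hlow, hlow] at this

theorem IsTauStandard.isStandard (hlam : ∀ i, IsDominantWeight b (lam i))
    (h : IsTauStandard b lam 𝓘 τ) {T : LSTableau b} (hT : IsOfType lam 𝓘 T)
    (hweak : IsWeaklyStandard T (proj (weight T) τ)) : IsStandard T (proj (weight T) τ) := by
  obtain ⟨Is, hIs, hshape⟩ := hT
  obtain ⟨C, rfl, rfl⟩ := exists_columns hshape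
  -- The entries are not yet known to lie below τ, so the relation is phrased for all elements of
  -- `WLow` over them.
  let R : (Σ I : 𝓘, Cosets P (colWeight lam I)) → (Σ I : 𝓘, Cosets P (colWeight lam I)) → Prop :=
    fun e e' => ∀ z z' : WLow b lam 𝓘 τ, z.1 = e → z'.1 = e' → z.GE z'
  have hR : ∀ {d : List (WUp b lam 𝓘 τ)}, d.IsChain WUp.GE → (d.map WUp.down).IsChain R := by
    intro d hd
    rw [List.isChain_map]
    refine hd.imp fun x y hxy z z' hz hz' => ?_
    obtain rfl : x.toLow hlam = z := Subtype.ext hz.symm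
    obtain rfl : y.toLow hlam = z' := Subtype.ext hz'.symm
    exact .single (hxy.rel hlam)
  have hsingle : ∀ c ∈ C, ∃ d : List (WUp b lam 𝓘 τ), d.IsChain WUp.GE ∧
      d.map WUp.down = c.cosets := by
    intro c hc
    have h1 := hweak.1 _ (List.mem_map_of_mem hc)
    have h2 := proj_weight_proj hlam (C := C) (C' := [c]) (by simpa using hc) τ
    have h3 := (isStandard_iff hlam (C := [c]) (τ := τ) (by simp)).mp (h2 ▸ h1)
    simpa using h3
  have hE : ∀ e ∈ C.flatMap Column.cosets, ∃ z : WLow b lam 𝓘 τ, z.1 = e := by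
    intro e he
    obtain ⟨c, hc, he⟩ := List.mem_flatMap.mp he
    obtain ⟨d, -, hd⟩ := hsingle c hc
    rw [← hd] at he
    obtain ⟨x, -, rfl⟩ := List.mem_map.mp he
    exact ⟨x.toLow hlam, rfl⟩
  have hchain : (C.flatMap Column.cosets).IsChain R := by
    rw [List.flatMap_def]
    refine (List.isChain_flatten ?_).mpr ⟨?_, ?_⟩
    · simp only [List.mem_map, not_exists, not_and]
      exact fun c _ => c.cosets_ne_nil
    · intro l hl
      obtain ⟨c, hc, rfl⟩ := List.mem_map.mp hl
      obtain ⟨d, hd, e⟩ := hsingle c hc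
      exact e ▸ hR hd
    · rw [List.isChain_map, List.isChain_iff_forall_rel_of_append_cons_cons]
      intro c c' l₁ l₂ e
      have h1 := hweak.2 c.toPath c'.toPath
        ⟨l₁.map Column.toPath, l₂.map Column.toPath, by simp [e]⟩
      have h2 := proj_weight_proj hlam (C := C) (C' := [c, c']) (by simp [e]) τ
      rw [e, List.map_append, List.map_cons, List.map_cons] at hIs
      obtain ⟨d, hd, hdE⟩ := (isStandard_iff hlam (C := [c, c']) (τ := τ)
        (by simpa using (List.isChain_append_cons_cons.mp hIs).2.1)).mp (h2 ▸ h1)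
      have h3 := hR hd
      rw [hdE] at h3
      simp only [List.flatMap_cons, List.flatMap_nil, List.append_nil] at h3
      exact (List.isChain_append.mp h3).2.2
  obtain ⟨Z, hZ⟩ : ∃ Z : List (WLow b lam 𝓘 τ), Z.map (fun z => z.1) = C.flatMap Column.cosets := by
    generalize C.flatMap Column.cosets = E at hE
    induction E with
    | nil => exact ⟨[], rfl⟩
    | cons e E ih =>
      obtain ⟨Z, rfl⟩ := ih fun e he => hE e (List.mem_cons_of_mem _ he)
      obtain ⟨z, rfl⟩ := hE e List.mem_cons_self
      exact ⟨z :: Z, rfl⟩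
  obtain ⟨f, hf, hmono⟩ := h.exists_lift
  refine (isStandard_iff hlam hIs).mpr ⟨Z.map f, ?_, ?_⟩
  · rw [← hZ, List.isChain_map] at hchain
    rw [List.isChain_map]
    exact hchain.imp fun z z' hzz' => hmono z z' (hzz' z z' rfl rfl)
  · rw [← hZ, List.map_map]
    exact List.map_congr_left fun z _ => hf z

/-- For (θ, I) and (φ, J) related by (*), the inserted element is the projection of min_Q(φ) at
level I. It lies below θ in W/W_{P_I}, so minimal lifts compare it with θ; at the other side
min_Q(φ) serves as a common lift. All these lifts lie below τ. -/
theorem exists_refinement (hlam : ∀ i, IsDominantWeight b (lam i)) {z : WLow b lam 𝓘 τ}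
    {Z : List (WLow b lam 𝓘 τ)} (hZ : (z :: Z).IsChain WLow.Rel) :
    ∃ Y, (z :: Y).IsChain (fun z z' => ∃ x x' : WUp b lam 𝓘 τ, x.toLow hlam = z ∧
      x'.toLow hlam = z' ∧ x.GE x') ∧ Z.Sublist Y := by
  induction Z generalizing z with
  | nil => exact ⟨[], List.isChain_singleton z, .slnil⟩
  | cons z' Z ih =>
    rw [List.isChain_cons_cons] at hZ
    obtain ⟨Y, hY, hsub⟩ := ih hZ.2
    obtain ⟨hl, a, c, ha, hc, hca⟩ := (WLow.rel_iff hlam).mp hZ.1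
    obtain ⟨x', hx', hmin'⟩ := z'.exists_minLift hlam
    have hxl : x'.1.2 = z'.1.1 := congrArg (fun z => z.1.1) hx'
    let y := WUp.mk x'.1.1 z.1.1 x'.2
    obtain ⟨x, hx, hmin⟩ := (y.toLow hlam).exists_minLift hlam
    obtain ⟨x₀, hx₀, hmin₀⟩ := z.exists_minLift hlam
    have h1 : cosetLE b x'.1.1 c := hmin' c (hc ▸ cosetLE_refl _)
    have h2 : cosetLE b x'.1.1 a := cosetLE_trans (isDominantWeight_total hlam) h1 hca
    have hxl₀ : x₀.1.2 = z.1.1 := congrArg (fun z => z.1.1) hx₀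
    have hxl' : x.1.2 = z.1.1 := congrArg (fun z => z.1.1) hx
    have h3 : x₀.GE x := by
      refine ⟨hxl'.trans_le hxl₀.ge, hmin _ ?_⟩
      have h4 : proj (colWeight lam z.1.1) x₀.1.1 = z.1.2 := by
        subst hx₀
        rfl
      change cosetLE b (proj (colWeight lam z.1.1) x'.1.1) (proj (colWeight lam z.1.1) x₀.1.1)
      rw [h4, ← ha]
      exact proj_cosetLE (stab_total_le hlam _) h2
    refine ⟨y.toLow hlam :: z' :: Y, ?_, .cons _ (hsub.cons_cons _)⟩
    rw [List.isChain_cons_cons, List.isChain_cons_cons]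
    exact ⟨⟨x₀, x, hx₀, hx, h3⟩, ⟨y, x', rfl, hx', hxl.trans_le hl, cosetLE_refl _⟩, hY⟩

theorem chainsLift_of_isStandard (hlam : ∀ i, IsDominantWeight b (lam i))
    (h : ∀ T : LSTableau b, IsOfType lam 𝓘 T → IsWeaklyStandard T (proj (weight T) τ) →
      IsStandard T (proj (weight T) τ)) : ChainsLift 𝓘 τ hlam := by
  intro Z hZ
  obtain ⟨Y, hY, hsub⟩ : ∃ Y : List (WLow b lam 𝓘 τ), Y.IsChain (fun z z' =>
      ∃ x x' : WUp b lam 𝓘 τ, x.toLow hlam = z ∧ x'.toLow hlam = z' ∧ x.GE x') ∧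
      Z.Sublist Y := by
    cases Z with
    | nil => exact ⟨[], List.isChain_nil, .slnil⟩
    | cons z Z =>
      obtain ⟨Y, hY, hsub⟩ := exists_refinement hlam hZ
      exact ⟨z :: Y, hY, hsub.cons_cons z⟩
  set C : List (Column b lam 𝓘) := Y.map fun z => Column.single z.1 with hC
  have hlevels : (C.map Sigma.fst).IsChain fun I J => J ≤ I := by
    rw [hC, List.map_map, List.isChain_map]
    refine hY.imp ?_
    rintro _ _ ⟨x, x', rfl, rfl, hxx'⟩
    exact hxx'.1
  have hcosets : ∀ Y : List (WLow b lam 𝓘 τ),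
      (Y.map fun z => Column.single (b := b) z.1).flatMap Column.cosets = Y.map fun z => z.1 := by
    intro Y
    rw [List.flatMap_map]
    simp only [Column.cosets_single]
    exact List.flatMap_pure_eq_map _ _
  have hshape : shape (C.map Column.toPath) = (C.map Sigma.fst).map (colWeight lam) := by
    simp [shape, Column.toPath]
  have hstd := h (C.map Column.toPath) ⟨_, hlevels, hshape⟩ ⟨?_, ?_⟩
  · obtain ⟨d, hd, hdE⟩ := (isStandard_iff hlam hlevels).mp hstd
    rw [hC, hcosets] at hdE
    have hdY : d.map (WUp.toLow hlam) = Y := by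
      have hinj : Function.Injective (fun z : WLow b lam 𝓘 τ => z.1) := fun _ _ h => Subtype.ext h
      refine List.map_injective_iff.mpr hinj ?_
      rw [List.map_map]
      exact hdE
    rw [← hdY] at hsub
    -- The lifts of the inserted elements are dropped again; transitivity keeps the rest decreasing.
    obtain ⟨d', hd', rfl⟩ := List.sublist_map_iff.mp hsub
    have htrans : IsTrans (WUp b lam 𝓘 τ) WUp.GE := ⟨fun _ _ _ h h' => h.trans hlam h'⟩
    exact ⟨d', ((List.isChain_iff_pairwise.mp hd).sublist hd').isChain, rfl⟩
  · intro p hp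
    obtain ⟨c, hc, rfl⟩ := List.mem_map.mp hp
    obtain ⟨z, hz, rfl⟩ := List.mem_map.mp hc
    have h2 := proj_weight_proj hlam (C := C) (C' := [Column.single z.1]) (by simpa using hc) τ
    obtain ⟨x, rfl, -⟩ := z.exists_minLift hlam
    have h3 := (isStandard_iff hlam (C := [Column.single (b := b) (x.toLow hlam).1]) (τ := τ)
      (by simp)).mpr ⟨[x], List.isChain_singleton x, (hcosets [x.toLow hlam]).symm⟩
    rw [← h2] at h3
    exact h3
  · have hmem : ∀ z ∈ Y, Column.single z.1 ∈ C := fun z hz => List.mem_map_of_mem hz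
    have hch : (C.map Column.toPath).IsChain fun p q => IsStandard [p, q]
        (proj (weight [p, q]) (proj (weight (C.map Column.toPath)) τ)) := by
      rw [List.isChain_map, hC, List.isChain_map, ← hC]
      rw [List.isChain_iff_forall_rel_of_append_cons_cons] at hY ⊢
      intro z z' l₁ l₂ e
      obtain ⟨x, x', rfl, rfl, hxx'⟩ := hY e
      have h2 := proj_weight_proj hlam (C := C)
        (C' := [Column.single (x.toLow hlam).1, Column.single (x'.toLow hlam).1])
        (List.cons_subset.mpr ⟨hmem _ (by rw [e]; simp),
          List.cons_subset.mpr ⟨hmem _ (by rw [e]; simp), List.nil_subset _⟩⟩) τ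
      have h3 := (isStandard_iff hlam
        (C := [Column.single (b := b) (x.toLow hlam).1, Column.single (x'.toLow hlam).1]) (τ := τ)
        (List.isChain_pair.mpr hxx'.1)).mpr
          ⟨[x, x'], List.isChain_pair.mpr hxx', (hcosets [x.toLow hlam, x'.toLow hlam]).symm⟩
      rw [← h2] at h3
      exact h3
    intro p q hpq
    have := hch.infix hpq
    rwa [List.isChain_pair] at this

end Main

end LSTableaux

end

theorem mainTheorem6 {ι M N : Type*} [Finite ι] [AddCommGroup M] [Module ℚ M]
    [AddCommGroup N] [Module ℚ N] (P : RootPairing ι ℚ M N)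
    [P.IsRootSystem] [P.IsCrystallographic] [P.IsReduced] [P.IsIrreducible]
    (b : P.Base) {m : ℕ} (lam : Fin m → M)
    (hlam : ∀ i, LSTableaux.IsDominantWeight b (lam i))
    (𝓘 : Set (Finset (Fin m))) (h𝓘 : LSTableaux.IsIndexPoset 𝓘)
    (τ : LSTableaux.Cosets P (∑ i, lam i)) :
    (LSTableaux.IsTauStandard b lam 𝓘 τ ↔
      ∀ T : LSTableaux.LSTableau b, LSTableaux.IsOfType lam 𝓘 T →
        LSTableaux.IsWeaklyStandard T (LSTableaux.proj (LSTableaux.weight T) τ) →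
          LSTableaux.IsStandard T (LSTableaux.proj (LSTableaux.weight T) τ)) ∧
    (LSTableaux.IsTauStandard b lam 𝓘 τ →
      ∀ x y z : LSTableaux.WLow b lam 𝓘 τ, x.Rel y → y.Rel z → x.Rel z) :=
  ⟨⟨fun h _ hT hweak => h.isStandard hlam hT hweak,
    fun h => (LSTableaux.chainsLift_of_isStandard hlam h).isTauStandard h𝓘⟩,
    fun h _ _ _ hxy hyz => h.rel_trans hlam hxy hyz⟩
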